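/- Let $N\ge 0$ be an integer. Order the $2N$ vertices by $1<2<\dots<N<\overline N<\dots<\overline 2<\overline 1$ and put $|a|=|\overline a|=a$. An *Okada arc-diagram* of rank $N$ is a non-crossing perfect matching of these vertices in which every arc $\{a,b\}$ carries a height label $h(a,b)$ such that (1) $1\le h(a,b)\le\min(|a|,|b|)$; (2) $h(a,b)\equiv\min(|a|,|b|)\pmod 2$; (3) $h(a,b)>h(c,d)$ whenever $c<a<b<d$. The *Okada monoid* $O_N$ is the set of these diagrams, where the product of $C$ and $D$ is obtained by merging the vertex $\overline a$ of $C$ with the vertex $a$ of $D$ for each $a$, concatenating arcs, labelling each resulting arc by the minimum of the labels of the arcs that compose it, and deleting closed loops; the unit consists of the arcs $\{a,\overline a\}$ with label $a$. The *mirror* of a diagram is obtained by exchanging $a$ and $\overline a$ for all $a$; an element is *involutive* if it equals its mirror. The *propagating set* of a diagram is the set of labels of its arcs joining some $a$ to some $\overline b$. For $1\le i<N$ let $E_i$ be the diagram with arcs $\{i,i+1\}$, $\{\overline i,\overline{i+1}\}$ labelled $i$ and $\{a,\overline a\}$ labelled $a$ for $a\ne i,i+1$. A *Fibonacci set* of rank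 $N$ is a set $S=\{s_1<\dots<s_k\}\subseteq\{1,\dots,N\}$ with $k\equiv N\pmod 2$ and $s_\ell\equiv\ell\pmod 2$ for all $\ell$; its *free element* is the product of the (pairwise commuting) $E_i$ over all $i\in\{1,\dots,N-1\}\setminus S$ such that $i-\max\{s\in S: s<i\}$ is odd, with $\max\emptyset=0$. A *free element* of $O_N$ is the free element of some Fibonacci set of rank $N$. Two elements $e,f\in O_N$ are $\mathcal R$-equivalent if $eO_N=fO_N$, and $\mathcal J$-equivalent if $O_NeO_N=O_NfO_N$. **Theorem.** Each $\mathcal R$-class of $O_N$ contains exactly one involutive element. Each $\mathcal J$-class of $O_N$ contains exactly one free element. Moreover, the free element in the $\mathcal J$-class of $e\in O_N$ is the free element having the same propagating set as $e$: a free element $f$ is $\mathcal J$-equivalent to $e$ if and only if $f$ and $e$ have the same propagating set. -/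

import Mathlib

/-- Vertices of a rank `N` arc-diagram are the positions `0, …, 2N-1` in the total order
`1 < 2 < ⋯ < N < N̄ < ⋯ < 2̄ < 1̄`: the position `p < N` is the left vertex `p + 1`, the position
`p ≥ N` is the right vertex `\overline{2N - p}`. This is the absolute value of the vertex. -/
def vertexAbs {N : ℕ} (p : Fin (2 * N)) : ℕ :=
  if (p : ℕ) < N then (p : ℕ) + 1 else 2 * N - (p : ℕ)

/-- Okada arc-diagrams of rank `N`: a non-crossing perfect matching of the `2N` vertices, together
with a height label for each arc (recorded at both of its endpoints). -/
@[ext]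
structure OkadaDiagram (N : ℕ) where
  /-- the other endpoint of the arc through a vertex -/
  partner : Fin (2 * N) → Fin (2 * N)
  /-- the height label of the arc through a vertex -/
  height : Fin (2 * N) → ℕ
  partner_partner : ∀ p, partner (partner p) = p
  partner_ne : ∀ p, partner p ≠ p
  height_partner : ∀ p, height (partner p) = height p
  noncrossing : ∀ a c, a < c → c < partner a → ¬ partner a < partner c
  one_le_height : ∀ p, 1 ≤ height p
  height_le : ∀ p, height p ≤ min (vertexAbs p) (vertexAbs (partner p))
  height_parity : ∀ p, height p ≡ min (vertexAbs p) (vertexAbs (partner p)) [MOD 2]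
  height_lt_of_nested : ∀ a c, c < a → a < partner a → partner a < partner c →
    height c < height a

namespace OkadaDiagram

variable {N : ℕ}

/-! ### Composition

In the concatenation of `C` (on the left) and `D` (on the right), a state `(false, p)` stands for
the vertex `p` of `C` and `(true, p)` for the vertex `p` of `D`. The right vertex `\overline{a}` of
`C` is merged with the left vertex `a` of `D`; in terms of positions, `p` is merged with
`Fin.rev p`. -/

/-- The diagram in which a state lives. -/
def pick (C D : OkadaDiagram N) : Bool → OkadaDiagram N
  | false => C
  | true => D

/-- Follow the arc of `C` or `D` that starts at a state to its other end. -/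
def across (C D : OkadaDiagram N) (x : Bool × Fin (2 * N)) : Bool × Fin (2 * N) :=
  (x.1, (pick C D x.1).partner x.2)

/-- Change the diagram at a merged vertex. -/
def swap (x : Bool × Fin (2 * N)) : Bool × Fin (2 * N) := (!x.1, x.2.rev)

/-- Follow an arc to its end, then change the diagram. -/
def trace (C D : OkadaDiagram N) (x : Bool × Fin (2 * N)) : Bool × Fin (2 * N) :=
  swap (across C D x)

/-- The height label of the arc through a state. -/
def fragHeight (C D : OkadaDiagram N) (x : Bool × Fin (2 * N)) : ℕ :=
  (pick C D x.1).height x.2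

/-- The states on the outer boundary: left vertices of `C` and right vertices of `D`. -/
def IsOuter (x : Bool × Fin (2 * N)) : Prop := x.1 = decide (N ≤ (x.2 : ℕ))

instance (x : Bool × Fin (2 * N)) : Decidable (IsOuter x) := by
  unfold IsOuter; infer_instance

/-- The state on the outer boundary that a vertex of the composition is. -/
def entry (p : Fin (2 * N)) : Bool × Fin (2 * N) := (decide (N ≤ (p : ℕ)), p)

theorem isOuter_entry (p : Fin (2 * N)) : IsOuter (entry p) := rfl

theorem isOuter_false (p : Fin (2 * N)) : IsOuter (false, p) ↔ (p : ℕ) < N := by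
  simp [IsOuter]

theorem isOuter_true (p : Fin (2 * N)) : IsOuter (true, p) ↔ N ≤ (p : ℕ) := by
  simp [IsOuter]

theorem swap_swap (x : Bool × Fin (2 * N)) : swap (swap x) = x := by
  simp [swap]

theorem across_across (C D : OkadaDiagram N) (x : Bool × Fin (2 * N)) :
    across C D (across C D x) = x := by
  simp [across, partner_partner]

theorem isOuter_swap (x : Bool × Fin (2 * N)) : IsOuter (swap x) ↔ IsOuter x := by
  obtain ⟨b, p⟩ := x
  have := p.isLt
  cases b <;> simp [IsOuter, swap, Fin.val_rev] <;> omega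

theorem trace_injective (C D : OkadaDiagram N) : Function.Injective (trace C D) := by
  intro x y h
  have h1 : across C D x = across C D y := by
    rw [← swap_swap (across C D x), ← swap_swap (across C D y)]; exact congrArg swap h
  rw [← across_across C D x, ← across_across C D y, h1]

theorem exists_return (C D : OkadaDiagram N) (p : Fin (2 * N)) :
    ∃ k, 0 < k ∧ IsOuter ((trace C D)^[k] (entry p)) := by
  obtain ⟨k, hk, h⟩ := (trace_injective C D).mem_periodicPts (entry p)
  exact ⟨k, hk, by rw [h.eq]; exact isOuter_entry p⟩

/-- The number of arcs of `C` and `D` that form the arc of the composition through `p`: the arcs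
are followed, starting at `p`, until the outer boundary is reached. -/
def compLength (C D : OkadaDiagram N) (p : Fin (2 * N)) : ℕ := Nat.find (exists_return C D p)

/-- The other end of the arc of the composition through `p`. -/
def compPartner (C D : OkadaDiagram N) (p : Fin (2 * N)) : Fin (2 * N) :=
  (across C D ((trace C D)^[compLength C D p - 1] (entry p))).2

theorem compLength_pos (C D : OkadaDiagram N) (p : Fin (2 * N)) : 0 < compLength C D p :=
  (Nat.find_spec (exists_return C D p)).1

/-- The height label of the arc of the composition through `p`: the minimum of the labels of the
arcs of `C` and `D` that form it. -/
def compHeight (C D : OkadaDiagram N) (p : Fin (2 * N)) : ℕ :=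
  (Finset.range (compLength C D p)).inf'
    (Finset.nonempty_range_iff.mpr (compLength_pos C D p).ne')
    (fun i => fragHeight C D ((trace C D)^[i] (entry p)))

/-! ### The composition is an Okada arc-diagram -/

theorem isOuter_return (C D : OkadaDiagram N) (p : Fin (2 * N)) :
    IsOuter ((trace C D)^[compLength C D p] (entry p)) :=
  (Nat.find_spec (exists_return C D p)).2

theorem not_isOuter_of_lt (C D : OkadaDiagram N) (p : Fin (2 * N)) {i : ℕ} (h0 : 0 < i)
    (hi : i < compLength C D p) : ¬ IsOuter ((trace C D)^[i] (entry p)) := fun h =>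
  Nat.find_min (exists_return C D p) hi ⟨h0, h⟩

theorem eq_entry {x : Bool × Fin (2 * N)} (h : IsOuter x) : x = entry x.2 := by
  ext1
  · exact h
  · rfl

/-- The end of the traced path is the entry state of the partner. -/
theorem across_last (C D : OkadaDiagram N) (p : Fin (2 * N)) :
    across C D ((trace C D)^[compLength C D p - 1] (entry p)) = entry (compPartner C D p) := by
  apply eq_entry
  rw [← isOuter_swap]
  have h := isOuter_return C D p
  have hk := compLength_pos C D p
  obtain ⟨k, hk'⟩ : ∃ k, compLength C D p = k + 1 := ⟨_, (Nat.succ_pred_eq_of_pos hk).symm⟩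
  rw [hk', Function.iterate_succ_apply'] at h
  rw [hk']
  exact h

theorem return_eq (C D : OkadaDiagram N) (p : Fin (2 * N)) :
    (trace C D)^[compLength C D p] (entry p) = swap (entry (compPartner C D p)) := by
  rw [← across_last]
  have hk := compLength_pos C D p
  obtain ⟨k, hk'⟩ : ∃ k, compLength C D p = k + 1 := ⟨_, (Nat.succ_pred_eq_of_pos hk).symm⟩
  rw [hk', Function.iterate_succ_apply']
  rfl

theorem trace_reverse (C D : OkadaDiagram N) (p : Fin (2 * N)) :
    ∀ i, i ≤ compLength C D p → (trace C D)^[i] (entry (compPartner C D p)) =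
      swap ((trace C D)^[compLength C D p - i] (entry p)) := by
  intro i
  induction i with
  | zero => intro _; rw [Nat.sub_zero, return_eq, swap_swap]; rfl
  | succ i ih =>
    intro hi
    rw [Function.iterate_succ_apply', ih (by omega)]
    obtain ⟨j, hj⟩ : ∃ j, compLength C D p - i = j + 1 := ⟨compLength C D p - i - 1, by omega⟩
    rw [hj, Function.iterate_succ_apply', show compLength C D p - (i + 1) = j by omega]
    simp only [trace, swap_swap, across_across]

theorem compLength_compPartner (C D : OkadaDiagram N) (p : Fin (2 * N)) :
    compLength C D (compPartner C D p) = compLength C D p := by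
  have hk := compLength_pos C D p
  conv_lhs => rw [compLength]
  rw [Nat.find_eq_iff]
  refine ⟨⟨hk, ?_⟩, ?_⟩
  · rw [trace_reverse C D p _ le_rfl, Nat.sub_self, isOuter_swap]; exact isOuter_entry p
  · rintro i hi ⟨h0, h⟩
    rw [trace_reverse C D p _ hi.le, isOuter_swap] at h
    exact not_isOuter_of_lt C D p (by omega) (by omega) h

theorem compPartner_compPartner (C D : OkadaDiagram N) (p : Fin (2 * N)) :
    compPartner C D (compPartner C D p) = p := by
  have h := return_eq C D (compPartner C D p)
  rw [compLength_compPartner, trace_reverse C D p _ le_rfl, Nat.sub_self] at h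
  have h2 := congrArg (fun x => (swap x).2) h
  simpa [swap_swap, entry] using h2.symm

theorem fragHeight_across (C D : OkadaDiagram N) (x : Bool × Fin (2 * N)) :
    fragHeight C D (across C D x) = fragHeight C D x := by
  simp [fragHeight, across, height_partner]

theorem compHeight_le (C D : OkadaDiagram N) (p : Fin (2 * N)) {i : ℕ}
    (hi : i < compLength C D p) :
    compHeight C D p ≤ fragHeight C D ((trace C D)^[i] (entry p)) :=
  Finset.inf'_le _ (Finset.mem_range.mpr hi)

theorem exists_compHeight_eq (C D : OkadaDiagram N) (p : Fin (2 * N)) :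
    ∃ i, i < compLength C D p ∧
      compHeight C D p = fragHeight C D ((trace C D)^[i] (entry p)) := by
  obtain ⟨i, hi, h⟩ := Finset.exists_mem_eq_inf'
    (Finset.nonempty_range_iff.mpr (compLength_pos C D p).ne')
    (fun i => fragHeight C D ((trace C D)^[i] (entry p)))
  exact ⟨i, Finset.mem_range.mp hi, h⟩

theorem compHeight_compPartner_le (C D : OkadaDiagram N) (p : Fin (2 * N)) :
    compHeight C D (compPartner C D p) ≤ compHeight C D p := by
  obtain ⟨i, hi, h⟩ := exists_compHeight_eq C D p
  have h2 := compHeight_le C D (compPartner C D p) (i := compLength C D p - 1 - i)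
    (by rw [compLength_compPartner]; omega)
  rw [trace_reverse C D p _ (by omega),
    show compLength C D p - (compLength C D p - 1 - i) = i + 1 by omega,
    Function.iterate_succ_apply', trace, swap_swap, fragHeight_across] at h2
  omega

theorem compHeight_compPartner (C D : OkadaDiagram N) (p : Fin (2 * N)) :
    compHeight C D (compPartner C D p) = compHeight C D p := by
  apply le_antisymm (compHeight_compPartner_le C D p)
  have := compHeight_compPartner_le C D (compPartner C D p)
  rwa [compPartner_compPartner] at this

/-- Points strictly inside an arc are matched inside that arc. -/
theorem partner_mem_between (D : OkadaDiagram N) {a c : Fin (2 * N)} (h1 : a < c)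
    (h2 : c < D.partner a) : a < D.partner c ∧ D.partner c < D.partner a := by
  have e1 := D.partner_partner a
  have e2 := D.partner_partner c
  constructor
  · by_contra h
    rcases lt_or_eq_of_le (not_lt.mp h) with h | h
    · have := D.noncrossing (D.partner c) a h (by rwa [e2])
      rw [e2] at this; exact this h2
    · rw [← h, e2] at h2; exact lt_irrefl _ h2
  · by_contra h
    rcases lt_or_eq_of_le (not_lt.mp h) with h | h
    · exact D.noncrossing a c h1 h2 h
    · rw [← e1, h, e2] at h1; exact lt_irrefl _ h1

open Classical in
/-- The number, modulo 2, of elements of `Q` before `p`. -/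
noncomputable def below (Q : Set (Fin (2 * N))) (p : Fin (2 * N)) : ZMod 2 :=
  ∑ y, if y ∈ Q ∧ y < p then 1 else 0

open Classical in
theorem sum_eq_zero_of_closed (D : OkadaDiagram N) (P : Fin (2 * N) → Prop)
    (hP : ∀ y, P y → P (D.partner y)) : (∑ y, if P y then (1 : ZMod 2) else 0) = 0 := by
  rw [← Finset.sum_filter]
  refine Finset.sum_involution (fun y _ => D.partner y) ?_ ?_ ?_ ?_
  · intro a _; exact CharTwo.add_self_eq_zero 1
  · intro a _ _; exact D.partner_ne a
  · intro a ha; simp only [Finset.mem_filter, Finset.mem_univ, true_and] at ha ⊢; exact hP a ha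
  · intro a _; exact D.partner_partner a

open Classical in
theorem below_partner_of_lt (D : OkadaDiagram N) (Q : Set (Fin (2 * N)))
    (hQ : ∀ y ∈ Q, D.partner y ∈ Q) {p : Fin (2 * N)} (hp : p < D.partner p) :
    below Q (D.partner p) = below Q p + if p ∈ Q then 1 else 0 := by
  have h := sum_eq_zero_of_closed D (fun y => y ∈ Q ∧ p < y ∧ y < D.partner p) (by
    rintro y ⟨h1, h2, h3⟩
    exact ⟨hQ y h1, partner_mem_between D h2 h3⟩)
  have h3 : (∑ y, if y = p then (if p ∈ Q then (1 : ZMod 2) else 0) else 0) =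
      if p ∈ Q then 1 else 0 := by simp
  rw [← h3, ← add_zero (below Q p + _)]
  refine Eq.trans ?_ (congrArg (fun z => below Q p +
    (∑ y, if y = p then (if p ∈ Q then (1 : ZMod 2) else 0) else 0) + z) h)
  simp only [below]
  rw [← Finset.sum_add_distrib, ← Finset.sum_add_distrib]
  refine Finset.sum_congr rfl fun y _ => ?_
  by_cases hy : y ∈ Q
  · rcases lt_trichotomy y p with h4 | h4 | h4
    · have := h4.trans hp
      simp [hy, h4, this, h4.ne, h4.not_gt]
    · subst h4; simp [hy, hp]
    · simp [hy, h4, h4.ne', h4.not_gt]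
  · have : y = p → p ∉ Q := fun e => e ▸ hy
    by_cases h5 : y = p <;> simp_all

open Classical in
theorem below_partner (D : OkadaDiagram N) (Q : Set (Fin (2 * N)))
    (hQ : ∀ y ∈ Q, D.partner y ∈ Q) (p : Fin (2 * N)) :
    below Q (D.partner p) = below Q p + if p ∈ Q then 1 else 0 := by
  rcases lt_or_gt_of_ne (D.partner_ne p) with h | h
  · have h2 := below_partner_of_lt D Q hQ (p := D.partner p) (by rwa [D.partner_partner])
    have h3 : D.partner p ∈ Q ↔ p ∈ Q :=
      ⟨fun h => D.partner_partner p ▸ hQ _ h, fun h => hQ p h⟩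
    rw [D.partner_partner] at h2
    simp only [h3] at h2
    rw [h2, add_assoc, CharTwo.add_self_eq_zero, add_zero]
  · exact below_partner_of_lt D Q hQ h

/-- If `Q` has an odd number of elements before `p`, an arc in `Q` nests the arc of `p`. -/
theorem exists_nesting (D : OkadaDiagram N) (Q : Set (Fin (2 * N)))
    (hQ : ∀ y ∈ Q, D.partner y ∈ Q) {p : Fin (2 * N)} (hp : p < D.partner p)
    (h : below Q p = 1) : ∃ y ∈ Q, D.height y < D.height p := by
  classical
  by_contra hcon
  push Not at hcon
  have h0 : below Q p = 0 := by
    rw [below]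
    convert sum_eq_zero_of_closed D (fun y => y ∈ Q ∧ y < p) ?_
    rintro y ⟨h1, h2⟩
    refine ⟨hQ y h1, ?_⟩
    by_contra h3
    rcases lt_or_eq_of_le (not_lt.mp h3) with h3 | h3
    · have h4 := (partner_mem_between D h2 h3).2
      exact absurd (D.height_lt_of_nested p y h2 hp h4) (not_lt.mpr (hcon y h1))
    · have h5 : D.partner p = y := by rw [h3, D.partner_partner]
      rw [h5] at hp; exact lt_asymm hp h2
  rw [h0] at h
  exact absurd h (by decide)

theorem below_univ (p : Fin (2 * N)) : below Set.univ p = ((p : ℕ) : ZMod 2) := by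
  classical
  rw [below]
  simp only [Set.mem_univ, true_and]
  rw [← Finset.sum_filter, Finset.sum_const, nsmul_eq_mul, mul_one]
  congr 1
  have : (Finset.univ.filter fun y => y < p) = Finset.Iio p := by ext; simp
  rw [this, Fin.card_Iio]

theorem cast_partner (D : OkadaDiagram N) (p : Fin (2 * N)) :
    ((D.partner p : ℕ) : ZMod 2) = (p : ℕ) + 1 := by
  have := below_partner D Set.univ (fun _ _ => Set.mem_univ _) p
  simpa [below_univ] using this

theorem min_abs_parity {p q : Fin (2 * N)} (h : ((q : ℕ) : ZMod 2) = (p : ℕ) + 1)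
    (hlt : p < q) : min (vertexAbs p) (vertexAbs q) ≡ (p : ℕ) + 1 [MOD 2] := by
  have h' : (q : ℕ) ≡ (p : ℕ) + 1 [MOD 2] := by
    rw [← ZMod.natCast_eq_natCast_iff]; push_cast; exact h
  unfold Nat.ModEq at *
  have := p.isLt
  have := q.isLt
  have : (p : ℕ) < q := hlt
  unfold vertexAbs
  split_ifs <;> omega

/-- A set of states is saturated if it is a union of connected components. -/
structure Saturated (C D : OkadaDiagram N) (Q : Set (Bool × Fin (2 * N))) : Prop where
  across_mem : ∀ x ∈ Q, across C D x ∈ Q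
  swap_mem : ∀ x ∈ Q, ¬ IsOuter x → swap x ∈ Q

/-- The part of a set of states that lies in one of the two diagrams. -/
def slice (Q : Set (Bool × Fin (2 * N))) (b : Bool) : Set (Fin (2 * N)) := {y | (b, y) ∈ Q}

theorem Saturated.slice_closed {C D : OkadaDiagram N} {Q : Set (Bool × Fin (2 * N))}
    (hQ : Saturated C D Q) (b : Bool) :
    ∀ y ∈ slice Q b, (pick C D b).partner y ∈ slice Q b := fun y hy =>
  hQ.across_mem (b, y) hy

theorem Saturated.across_iff {C D : OkadaDiagram N} {Q : Set (Bool × Fin (2 * N))}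
    (hQ : Saturated C D Q) (x : Bool × Fin (2 * N)) : across C D x ∈ Q ↔ x ∈ Q :=
  ⟨fun h => across_across C D x ▸ hQ.across_mem _ h, hQ.across_mem x⟩

theorem Saturated.swap_iff {C D : OkadaDiagram N} {Q : Set (Bool × Fin (2 * N))}
    (hQ : Saturated C D Q) {x : Bool × Fin (2 * N)} (hx : ¬ IsOuter x) : swap x ∈ Q ↔ x ∈ Q :=
  ⟨fun h => swap_swap x ▸ hQ.swap_mem _ h (by rwa [isOuter_swap]), fun h => hQ.swap_mem x h hx⟩

/-- The parity of the number of elements of `Q` before a state, in its own diagram. -/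
noncomputable def depth (Q : Set (Bool × Fin (2 * N))) (x : Bool × Fin (2 * N)) : ZMod 2 :=
  below (slice Q x.1) x.2

open Classical in
theorem Saturated.depth_across {C D : OkadaDiagram N} {Q : Set (Bool × Fin (2 * N))}
    (hQ : Saturated C D Q) (x : Bool × Fin (2 * N)) :
    depth Q (across C D x) = depth Q x + if x ∈ Q then 1 else 0 :=
  below_partner (pick C D x.1) (slice Q x.1) (hQ.slice_closed x.1) x.2

open Classical in
theorem Saturated.depth_swap_aux {C D : OkadaDiagram N} {Q : Set (Bool × Fin (2 * N))}
    (hQ : Saturated C D Q) (p : Fin (2 * N)) (hp : N ≤ (p : ℕ)) :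
    depth Q (true, p.rev) = depth Q (false, p) + if (false, p) ∈ Q then 1 else 0 := by
  have h := sum_eq_zero_of_closed C (fun y => (false, y) ∈ Q) (hQ.slice_closed false)
  have h3 : (∑ y, if y = p then (if (false, p) ∈ Q then (1 : ZMod 2) else 0) else 0) =
      if (false, p) ∈ Q then 1 else 0 := by simp
  have e : ∀ a b : ZMod 2, a + b = 0 → a = b := by decide
  apply e
  rw [← h3]
  refine Eq.trans ?_ h
  simp only [depth, below]
  rw [← Equiv.sum_comp Fin.revPerm, ← Finset.sum_add_distrib, ← Finset.sum_add_distrib]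
  refine Finset.sum_congr rfl fun y _ => ?_
  simp only [slice, Set.mem_ofPred_eq, Fin.revPerm_apply, Fin.rev_lt_rev]
  rcases lt_trichotomy y p with h4 | h4 | h4
  · simp [h4, h4.ne, h4.not_gt]
  · subst h4; simp
  · have hy : ¬ IsOuter (false, y) := by
      have : (p : ℕ) < y := h4
      simp [IsOuter]; omega
    have := hQ.swap_iff hy
    simp only [swap, Bool.not_false] at this
    simp [h4, h4.ne', h4.not_gt, this]

open Classical in
theorem Saturated.depth_swap {C D : OkadaDiagram N} {Q : Set (Bool × Fin (2 * N))}
    (hQ : Saturated C D Q) {x : Bool × Fin (2 * N)} (hx : ¬ IsOuter x) :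
    depth Q (swap x) = depth Q x + if x ∈ Q then 1 else 0 := by
  obtain ⟨b, p⟩ := x
  cases b with
  | false =>
    exact hQ.depth_swap_aux p (by simpa [IsOuter] using hx)
  | true =>
    have hp : (p : ℕ) < N := by simpa [IsOuter] using hx
    have h := hQ.depth_swap_aux p.rev (by rw [Fin.val_rev]; omega)
    have h2 := hQ.swap_iff hx
    simp only [swap, Bool.not_true] at h2 ⊢
    rw [Fin.rev_rev] at h
    simp only [h2] at h
    rw [h, add_assoc, CharTwo.add_self_eq_zero, add_zero]

open Classical in
theorem Saturated.depth_trace {C D : OkadaDiagram N} {Q : Set (Bool × Fin (2 * N))}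
    (hQ : Saturated C D Q) {x : Bool × Fin (2 * N)} (hx : ¬ IsOuter (trace C D x)) :
    depth Q (trace C D x) = depth Q x := by
  rw [trace, isOuter_swap] at hx
  rw [trace, hQ.depth_swap hx, hQ.depth_across]
  simp only [hQ.across_iff]
  rw [add_assoc, CharTwo.add_self_eq_zero, add_zero]

theorem Saturated.depth_iterate {C D : OkadaDiagram N} {Q : Set (Bool × Fin (2 * N))}
    (hQ : Saturated C D Q) (p : Fin (2 * N)) : ∀ i, i < compLength C D p →
    depth Q ((trace C D)^[i] (entry p)) = depth Q (entry p) := by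
  intro i
  induction i with
  | zero => intro _; rfl
  | succ i ih =>
    intro hi
    rw [← ih (by omega), Function.iterate_succ_apply']
    apply hQ.depth_trace
    rw [← Function.iterate_succ_apply' (trace C D)]
    exact not_isOuter_of_lt C D p (by omega) hi

theorem Saturated.mem_iterate {C D : OkadaDiagram N} {Q : Set (Bool × Fin (2 * N))}
    (hQ : Saturated C D Q) (p : Fin (2 * N)) : ∀ i, i < compLength C D p →
    ((trace C D)^[i] (entry p) ∈ Q ↔ entry p ∈ Q) := by
  intro i
  induction i with
  | zero => intro _; rfl
  | succ i ih =>
    intro hi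
    have h := not_isOuter_of_lt C D p (by omega) hi
    rw [← ih (by omega)]
    rw [Function.iterate_succ_apply', trace] at h ⊢
    rw [isOuter_swap] at h
    rw [hQ.swap_iff h, hQ.across_iff]

open Classical in
theorem Saturated.depth_compPartner {C D : OkadaDiagram N} {Q : Set (Bool × Fin (2 * N))}
    (hQ : Saturated C D Q) (p : Fin (2 * N)) :
    depth Q (entry (compPartner C D p)) = depth Q (entry p) + if entry p ∈ Q then 1 else 0 := by
  have hk := compLength_pos C D p
  rw [← across_last, hQ.depth_across, hQ.depth_iterate p _ (by omega)]
  simp only [hQ.mem_iterate p _ (show compLength C D p - 1 < compLength C D p by omega)]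

/-- On the outer boundary, the depth is computed in the order of the composition. -/
theorem Saturated.depth_entry {C D : OkadaDiagram N} {Q : Set (Bool × Fin (2 * N))}
    (hQ : Saturated C D Q) (p : Fin (2 * N)) :
    depth Q (entry p) = below {y | entry y ∈ Q} p := by
  classical
  have e : ∀ a b : ZMod 2, a + b = 0 → a = b := by decide
  simp only [depth, below, entry, slice, Set.mem_ofPred_eq]
  by_cases hp : N ≤ (p : ℕ)
  · simp only [hp, decide_true]
    have h := sum_eq_zero_of_closed C (fun y => (false, y) ∈ Q) (hQ.slice_closed false)
    apply e
    have h2 : (∑ y : Fin (2 * N), if (true, y) ∈ Q ∧ (y : ℕ) < N then (1 : ZMod 2) else 0) =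
        ∑ y : Fin (2 * N), if (false, y) ∈ Q ∧ N ≤ (y : ℕ) then (1 : ZMod 2) else 0 := by
      rw [← Equiv.sum_comp Fin.revPerm]
      refine Finset.sum_congr rfl fun y _ => ?_
      simp only [Fin.revPerm_apply]
      by_cases hy : N ≤ (y : ℕ)
      · have hy' : ¬ IsOuter (false, y) := by simp [IsOuter]; omega
        have h3 := hQ.swap_iff hy'
        simp only [swap, Bool.not_false] at h3
        have : (y.rev : ℕ) < N := by rw [Fin.val_rev]; omega
        simp only [h3, hy, this]
      · have : ¬ (y.rev : ℕ) < N := by rw [Fin.val_rev]; omega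
        simp only [hy, this, and_false]
    have h4 : (∑ y : Fin (2 * N), if (true, y) ∈ Q ∧ (y : ℕ) < N then (1 : ZMod 2) else 0) +
        (∑ y : Fin (2 * N), if (false, y) ∈ Q ∧ (y : ℕ) < N then (1 : ZMod 2) else 0) = 0 := by
      rw [h2, ← Finset.sum_add_distrib]
      refine Eq.trans ?_ h
      refine Finset.sum_congr rfl fun y _ => ?_
      by_cases hy : N ≤ (y : ℕ)
      · simp [hy, not_lt.mpr hy]
      · simp [hy, not_le.mp hy]
    refine Eq.trans ?_ h4
    rw [← Finset.sum_add_distrib, ← Finset.sum_add_distrib]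
    refine Finset.sum_congr rfl fun y _ => ?_
    by_cases hy : N ≤ (y : ℕ)
    · have hN : ¬ (y : ℕ) < N := not_lt.mpr hy
      simp only [hy, decide_true, hN, and_false, if_false, add_zero]
      exact CharTwo.add_self_eq_zero _
    · have hyp : y < p := by
        rw [Fin.lt_def]; omega
      simp [hy, hyp, not_le.mp hy]
  · simp only [hp, decide_false]
    refine Finset.sum_congr rfl fun y _ => ?_
    by_cases hy : y < p
    · have : ¬ N ≤ (y : ℕ) := by
        have : (y : ℕ) < p := hy
        omega
      simp [this]
    · simp [hy]

/-- The states on the path through a vertex of the composition. -/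
def pathSet (C D : OkadaDiagram N) (p : Fin (2 * N)) : Set (Bool × Fin (2 * N)) :=
  {x | ∃ i, i < compLength C D p ∧
    (x = (trace C D)^[i] (entry p) ∨ x = across C D ((trace C D)^[i] (entry p)))}

theorem saturated_pathSet (C D : OkadaDiagram N) (p : Fin (2 * N)) :
    Saturated C D (pathSet C D p) := by
  constructor
  · rintro x ⟨i, hi, rfl | rfl⟩
    · exact ⟨i, hi, Or.inr rfl⟩
    · exact ⟨i, hi, Or.inl (across_across C D _)⟩
  · rintro x ⟨i, hi, rfl | rfl⟩ hx
    · cases i with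
      | zero => exact absurd (isOuter_entry p) hx
      | succ i =>
        refine ⟨i, by omega, Or.inr ?_⟩
        rw [Function.iterate_succ_apply', trace, swap_swap]
    · rw [← isOuter_swap] at hx
      change ¬ IsOuter (trace C D _) at hx
      rw [← Function.iterate_succ_apply' (trace C D)] at hx
      refine ⟨i + 1, ?_, Or.inl ?_⟩
      · by_contra h
        have : i + 1 = compLength C D p := by omega
        rw [Nat.succ_eq_add_one, this] at hx
        exact hx (isOuter_return C D p)
      · rw [Function.iterate_succ_apply']; rfl

theorem entry_mem_pathSet (C D : OkadaDiagram N) (p y : Fin (2 * N)) :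
    entry y ∈ pathSet C D p ↔ y = p ∨ y = compPartner C D p := by
  constructor
  · rintro ⟨i, hi, h | h⟩
    · left
      cases i with
      | zero => exact congrArg Prod.snd h
      | succ i =>
        exact absurd (h ▸ isOuter_entry y) (not_isOuter_of_lt C D p (Nat.succ_pos i) hi)
    · right
      by_cases hk : i + 1 = compLength C D p
      · have hi' : i = compLength C D p - 1 := by omega
        rw [hi', across_last] at h
        exact congrArg Prod.snd h
      · have h2 := not_isOuter_of_lt C D p (i := i + 1) (by omega) (by omega)
        rw [Function.iterate_succ_apply', trace, isOuter_swap, ← h] at h2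
        exact absurd (isOuter_entry y) h2
  · have hk := compLength_pos C D p
    rintro (rfl | rfl)
    · exact ⟨0, hk, Or.inl rfl⟩
    · exact ⟨_, Nat.sub_lt hk one_pos, Or.inr (across_last C D p).symm⟩

theorem compHeight_le_of_mem (C D : OkadaDiagram N) (p : Fin (2 * N))
    {x : Bool × Fin (2 * N)} (hx : x ∈ pathSet C D p) :
    compHeight C D p ≤ fragHeight C D x := by
  obtain ⟨i, hi, rfl | rfl⟩ := hx
  · exact compHeight_le C D p hi
  · rw [fragHeight_across]; exact compHeight_le C D p hi

theorem cast_trace (C D : OkadaDiagram N) (x : Bool × Fin (2 * N)) :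
    (((trace C D x).2 : ℕ) : ZMod 2) = ((x.2 : ℕ) : ZMod 2) := by
  have h := cast_partner (pick C D x.1) x.2
  simp only [trace, swap, across]
  set q := (pick C D x.1).partner x.2
  have h2 : ((q.rev : ℕ) : ZMod 2) + (q : ℕ) + 1 = 0 := by
    have : (q.rev : ℕ) + q + 1 = 2 * N := by rw [Fin.val_rev]; omega
    rw [← Nat.cast_add, ← Nat.cast_succ, Nat.succ_eq_add_one, this, Nat.cast_mul]
    have : ((2 : ℕ) : ZMod 2) = 0 := rfl
    rw [this, zero_mul]
  rw [h] at h2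
  have e : ∀ a b : ZMod 2, a + (b + 1) + 1 = 0 → a = b := by decide
  exact e _ _ h2

theorem cast_iterate (C D : OkadaDiagram N) (x : Bool × Fin (2 * N)) (i : ℕ) :
    ((((trace C D)^[i] x).2 : ℕ) : ZMod 2) = ((x.2 : ℕ) : ZMod 2) := by
  induction i with
  | zero => rfl
  | succ i ih => rw [Function.iterate_succ_apply', cast_trace, ih]

theorem cast_compPartner (C D : OkadaDiagram N) (p : Fin (2 * N)) :
    ((compPartner C D p : ℕ) : ZMod 2) = (p : ℕ) + 1 := by
  rw [compPartner]
  simp only [across]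
  rw [cast_partner, cast_iterate]
  rfl

theorem compPartner_ne (C D : OkadaDiagram N) (p : Fin (2 * N)) : compPartner C D p ≠ p := by
  intro h
  have := cast_compPartner C D p
  rw [h] at this
  have e : ∀ a : ZMod 2, a ≠ a + 1 := by decide
  exact e _ this

open Classical in
theorem below_pathSet (C D : OkadaDiagram N) (p q : Fin (2 * N)) :
    depth (pathSet C D p) (entry q) =
      (if p < q then 1 else 0) + (if compPartner C D p < q then 1 else 0) := by
  rw [(saturated_pathSet C D p).depth_entry, below]
  simp only [Set.mem_ofPred_eq, entry_mem_pathSet]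
  have hne := compPartner_ne C D p
  have h1 : (∑ y, if y = p then (if p < q then (1 : ZMod 2) else 0) else 0) =
      if p < q then 1 else 0 := by simp
  have h2 : (∑ y, if y = compPartner C D p then
      (if compPartner C D p < q then (1 : ZMod 2) else 0) else 0) =
      if compPartner C D p < q then 1 else 0 := by simp
  rw [← h1, ← h2, ← Finset.sum_add_distrib]
  refine Finset.sum_congr rfl fun y _ => ?_
  by_cases h3 : y = p
  · subst h3; simp [hne.symm]
  · by_cases h4 : y = compPartner C D p
    · subst h4; simp [hne]
    · simp [h3, h4]

theorem comp_noncrossing (C D : OkadaDiagram N) (a c : Fin (2 * N)) (h1 : a < c)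
    (h2 : c < compPartner C D a) : ¬ compPartner C D a < compPartner C D c := by
  classical
  intro h3
  have h := (saturated_pathSet C D a).depth_compPartner c
  have hc : entry c ∉ pathSet C D a := by
    rw [entry_mem_pathSet]; rintro (h | h)
    · exact h1.ne' h
    · exact h2.ne h
  rw [below_pathSet, below_pathSet, if_neg hc, if_pos h1, if_neg h2.not_gt, if_pos h3,
    if_pos ((h1.trans h2).trans h3)] at h
  exact absurd h (by decide)

/-- Every arc of a path that is enclosed by a saturated set is nested in an arc of that set. -/
theorem Saturated.exists_lower {C D : OkadaDiagram N} {Q : Set (Bool × Fin (2 * N))}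
    (hQ : Saturated C D Q) {x : Bool × Fin (2 * N)} (hx : x.2 < (across C D x).2)
    (h : depth Q x = 1) : ∃ y ∈ Q, fragHeight C D y < fragHeight C D x := by
  obtain ⟨y, hy, h⟩ := exists_nesting (pick C D x.1) (slice Q x.1) (hQ.slice_closed x.1) hx h
  exact ⟨(x.1, y), hy, h⟩

theorem comp_nested (C D : OkadaDiagram N) (a c : Fin (2 * N)) (h1 : c < a)
    (h2 : a < compPartner C D a) (h3 : compPartner C D a < compPartner C D c) :
    compHeight C D c < compHeight C D a := by
  classical
  obtain ⟨i, hi, he⟩ := exists_compHeight_eq C D a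
  have hQ := saturated_pathSet C D c
  have ha : entry a ∉ pathSet C D c := by
    rw [entry_mem_pathSet]; rintro (h | h)
    · exact h1.ne' h
    · exact (h2.trans h3).ne h
  have hd := hQ.depth_iterate a i hi
  have hm := hQ.mem_iterate a i hi
  rw [below_pathSet, if_pos h1, if_neg (h2.trans h3).not_gt, add_zero] at hd
  rw [he]
  set x := (trace C D)^[i] (entry a)
  have hx : x ∉ pathSet C D c := fun h => ha (hm.mp h)
  obtain ⟨y, hy, hlt⟩ : ∃ y ∈ pathSet C D c, fragHeight C D y < fragHeight C D x := by
    rcases lt_or_gt_of_ne ((pick C D x.1).partner_ne x.2) with h | h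
    · rw [← fragHeight_across]
      refine hQ.exists_lower ?_ ?_
      · rw [across_across]; exact h
      · rw [hQ.depth_across, hd, if_neg hx, add_zero]
    · exact hQ.exists_lower h hd
  exact lt_of_le_of_lt (compHeight_le_of_mem C D c hy) hlt

theorem comp_parity_of_lt (C D : OkadaDiagram N) (p : Fin (2 * N)) (hp : p < compPartner C D p) :
    compHeight C D p ≡ min (vertexAbs p) (vertexAbs (compPartner C D p)) [MOD 2] := by
  classical
  refine Nat.ModEq.trans ?_ (min_abs_parity (cast_compPartner C D p) hp).symm
  obtain ⟨i, hi, he⟩ := exists_compHeight_eq C D p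
  have hQ := saturated_pathSet C D p
  have hd := hQ.depth_iterate p i hi
  have hc := cast_iterate C D (entry p) i
  rw [below_pathSet, if_neg (lt_irrefl p), if_neg hp.not_gt, add_zero] at hd
  have hx : (trace C D)^[i] (entry p) ∈ pathSet C D p := ⟨i, hi, Or.inl rfl⟩
  set x := (trace C D)^[i] (entry p)
  have hlow : x.2 < (across C D x).2 := by
    rcases lt_or_gt_of_ne ((pick C D x.1).partner_ne x.2) with h | h
    · exfalso
      obtain ⟨y, hy, hlt⟩ := hQ.exists_lower (x := across C D x)
        (by rw [across_across]; exact h) (by rw [hQ.depth_across, hd, if_pos hx, zero_add])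
      rw [fragHeight_across, ← he] at hlt
      exact absurd (compHeight_le_of_mem C D p hy) (not_le.mpr hlt)
    · exact h
  rw [he]
  refine ((pick C D x.1).height_parity x.2).trans ?_
  refine (min_abs_parity (cast_partner (pick C D x.1) x.2) hlow).trans ?_
  have : (x.2 : ℕ) ≡ (p : ℕ) [MOD 2] := by
    rw [← ZMod.natCast_eq_natCast_iff]; exact hc
  exact this.add_right 1

theorem comp_parity (C D : OkadaDiagram N) (p : Fin (2 * N)) :
    compHeight C D p ≡ min (vertexAbs p) (vertexAbs (compPartner C D p)) [MOD 2] := by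
  rcases lt_or_gt_of_ne (compPartner_ne C D p) with h | h
  · have := comp_parity_of_lt C D (compPartner C D p) (by rwa [compPartner_compPartner])
    rwa [compPartner_compPartner, compHeight_compPartner, min_comm] at this
  · exact comp_parity_of_lt C D p h

theorem comp_height_le (C D : OkadaDiagram N) (p : Fin (2 * N)) :
    compHeight C D p ≤ vertexAbs p :=
  (compHeight_le C D p (compLength_pos C D p)).trans
    (((pick C D _).height_le _).trans (min_le_left _ _))

/-- The composition of Okada arc-diagrams, with its loops removed. -/
instance : Mul (OkadaDiagram N) where
  mul C D :=
    { partner := compPartner C D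
      height := compHeight C D
      partner_partner := compPartner_compPartner C D
      partner_ne := compPartner_ne C D
      height_partner := compHeight_compPartner C D
      noncrossing := comp_noncrossing C D
      one_le_height := fun p => by
        obtain ⟨i, _, h⟩ := exists_compHeight_eq C D p
        rw [h]; exact (pick C D _).one_le_height _
      height_le := fun p => le_min (comp_height_le C D p) (by
        rw [← compHeight_compPartner]; exact comp_height_le C D _)
      height_parity := comp_parity C D
      height_lt_of_nested := comp_nested C D }

/-- The identity diagram: the arcs `a - \overline{a}` with label `a`. -/
instance : One (OkadaDiagram N) where
  one :=
    { partner := Fin.rev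
      height := vertexAbs
      partner_partner := Fin.rev_rev
      partner_ne := fun p h => by
        have := congrArg Fin.val h
        rw [Fin.val_rev] at this; omega
      height_partner := fun p => by
        have := p.isLt
        unfold vertexAbs
        rw [Fin.val_rev]; split_ifs <;> omega
      noncrossing := fun a c h1 h2 h3 => by
        simp only [Fin.lt_def, Fin.val_rev] at *; omega
      one_le_height := fun p => by
        have := p.isLt
        unfold vertexAbs; split_ifs <;> omega
      height_le := fun p => by
        have := p.isLt
        unfold vertexAbs
        rw [Fin.val_rev]; split_ifs <;> omega
      height_parity := fun p => by
        have := p.isLt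
        unfold vertexAbs Nat.ModEq
        rw [Fin.val_rev]; split_ifs <;> omega
      height_lt_of_nested := fun a c h1 h2 h3 => by
        simp only [Fin.lt_def, Fin.val_rev, vertexAbs] at *
        split_ifs <;> omega }

theorem mul_partner (C D : OkadaDiagram N) (p : Fin (2 * N)) :
    (C * D).partner p = compPartner C D p := rfl

theorem mul_height (C D : OkadaDiagram N) (p : Fin (2 * N)) :
    (C * D).height p = compHeight C D p := rfl

theorem one_partner (p : Fin (2 * N)) : (1 : OkadaDiagram N).partner p = p.rev := rfl

theorem one_height (p : Fin (2 * N)) : (1 : OkadaDiagram N).height p = vertexAbs p := rfl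

/-! ### The monoid laws -/

/-- `Ret f O h x y m`: the first state in `O` after `x` under the iteration of `f` is `y`, and `m`
is the minimum of `h` on the states before `y`. -/
inductive Ret {X : Type*} (f : X → X) (O : X → Prop) (h : X → ℕ) : X → X → ℕ → Prop
  | last (x : X) (hx : O (f x)) : Ret f O h x (f x) (h x)
  | step (x y : X) (m : ℕ) (hx : ¬ O (f x)) (hr : Ret f O h (f x) y m) :
      Ret f O h x y (min (h x) m)

theorem Ret.unique {X : Type*} {f : X → X} {O : X → Prop} {h : X → ℕ} {x y y' : X} {m m' : ℕ}
    (h1 : Ret f O h x y m) (h2 : Ret f O h x y' m') : y = y' ∧ m = m' := by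
  induction h1 generalizing m' with
  | last x hx =>
    cases h2 with
    | last => exact ⟨rfl, rfl⟩
    | step _ _ _ hn => exact absurd hx hn
  | step x y m hx hr ih =>
    cases h2 with
    | last _ hn => exact absurd hn hx
    | step _ _ m2 _ hr2 =>
      obtain ⟨e1, e2⟩ := ih hr2
      exact ⟨e1, by rw [e2]⟩

theorem Ret.append {X : Type*} {f : X → X} {O O' : X → Prop} {h : X → ℕ}
    (hO : ∀ x, O x → O' x) {x z y : X} {m m' : ℕ} (h1 : Ret f O' h x z m) (hz : ¬ O z)
    (h2 : Ret f O h z y m') : Ret f O h x y (min m m') := by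
  induction h1 with
  | last x hx => exact Ret.step x y m' hz h2
  | step x z m hx hr ih =>
    rw [min_assoc]
    exact Ret.step x y _ (fun hn => hx (hO _ hn)) (ih hz h2)

theorem Ret.mono {X : Type*} {f : X → X} {O O' : X → Prop} {h : X → ℕ}
    (hO : ∀ x, O x → O' x) {x z : X} {m : ℕ} (h1 : Ret f O' h x z m) (hz : O z) :
    Ret f O h x z m := by
  induction h1 with
  | last x hx => exact Ret.last x hz
  | step x z m hx hr ih => exact Ret.step x z m (fun hn => hx (hO _ hn)) (ih hz)

theorem Ret.blocks {X Y : Type*} {f : X → X} {g : Y → Y} {O O' : X → Prop} {P : Y → Prop}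
    {h : X → ℕ} {k : Y → ℕ} (φ : Y → X) (hO : ∀ x, O x → O' x) (hP : ∀ y, O (φ y) ↔ P y)
    (hb : ∀ y, Ret f O' h (φ y) (φ (g y)) (k y)) {x y : Y} {m : ℕ} (h1 : Ret g P k x y m) :
    Ret f O h (φ x) (φ y) m := by
  induction h1 with
  | last x hx => exact (hb x).mono hO ((hP _).mpr hx)
  | step x y m hx hr ih => exact (hb x).append hO (fun hn => hx ((hP _).mp hn)) ih

theorem ret_of_iterate {X : Type*} (f : X → X) (O : X → Prop) (h : X → ℕ) (k : ℕ) :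
    ∀ x, O (f^[k + 1] x) → (∀ i, 0 < i → i < k + 1 → ¬ O (f^[i] x)) →
      Ret f O h x (f^[k + 1] x)
        ((Finset.range (k + 1)).inf' Finset.nonempty_range_add_one (fun i => h (f^[i] x))) := by
  induction k with
  | zero => intro x h1 _; exact Ret.last x h1
  | succ k ih =>
    intro x h1 h2
    have h3 := ih (f x) h1 (fun i hi hk => h2 (i + 1) (by omega) (by omega))
    have h4 := Ret.step x _ _ (h2 1 one_pos (by omega)) h3
    refine Eq.subst (motive := fun z => Ret f O h x (f^[k + 1 + 1] x) z) ?_ h4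
    symm
    apply le_antisymm
    · refine le_min (Finset.inf'_le (fun i => h (f^[i] x)) (b := 0) (by simp)) ?_
      refine Finset.le_inf' _ _ fun i hi => ?_
      exact Finset.inf'_le (fun i => h (f^[i] x)) (b := i + 1) (by simp at hi ⊢; omega)
    · refine Finset.le_inf' _ _ fun i hi => ?_
      cases i with
      | zero => exact min_le_left _ _
      | succ i =>
        refine (min_le_right _ _).trans ?_
        exact Finset.inf'_le (fun i => h (f^[i] (f x))) (b := i) (by simp at hi ⊢; omega)

theorem ret_comp (C D : OkadaDiagram N) (p : Fin (2 * N)) :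
    Ret (trace C D) IsOuter (fragHeight C D) (entry p) (swap (entry ((C * D).partner p)))
      ((C * D).height p) := by
  have aux : ∀ k (hk : (Finset.range k).Nonempty), IsOuter ((trace C D)^[k] (entry p)) →
      (∀ i, 0 < i → i < k → ¬ IsOuter ((trace C D)^[i] (entry p))) →
      Ret (trace C D) IsOuter (fragHeight C D) (entry p) ((trace C D)^[k] (entry p))
        ((Finset.range k).inf' hk (fun i => fragHeight C D ((trace C D)^[i] (entry p)))) := by
    intro k hk h1 h2
    cases k with
    | zero => simp at hk
    | succ k => exact ret_of_iterate _ _ _ k _ h1 h2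
  rw [mul_partner, mul_height, ← return_eq]
  exact aux _ _ (isOuter_return C D p) (fun i h0 hi => not_isOuter_of_lt C D p h0 hi)

theorem eq_of_ret (C D E : OkadaDiagram N)
    (h : ∀ p, Ret (trace C D) IsOuter (fragHeight C D) (entry p) (swap (entry (E.partner p)))
      (E.height p)) : C * D = E := by
  ext p
  · have := congrArg (fun x => (swap x).2) ((ret_comp C D p).unique (h p)).1
    simp only [swap_swap] at this
    exact congrArg Fin.val this
  · exact ((ret_comp C D p).unique (h p)).2

/-- The three diagrams of a triple composition. -/
def pick3 (C D E : OkadaDiagram N) (s : Fin 3) : OkadaDiagram N :=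
  if s = 0 then C else if s = 1 then D else E

/-- Tracing of arcs in the concatenation of three diagrams. -/
def trace3 (C D E : OkadaDiagram N) (x : Fin 3 × Fin (2 * N)) : Fin 3 × Fin (2 * N) :=
  (if ((pick3 C D E x.1).partner x.2 : ℕ) < N then x.1 - 1 else x.1 + 1,
    ((pick3 C D E x.1).partner x.2).rev)

theorem trace3_of_lt (C D E : OkadaDiagram N) (s : Fin 3) (p : Fin (2 * N))
    (h : ((pick3 C D E s).partner p : ℕ) < N) :
    trace3 C D E (s, p) = (s - 1, ((pick3 C D E s).partner p).rev) := by
  simp only [trace3, if_pos h]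

theorem trace3_of_le (C D E : OkadaDiagram N) (s : Fin 3) (p : Fin (2 * N))
    (h : N ≤ ((pick3 C D E s).partner p : ℕ)) :
    trace3 C D E (s, p) = (s + 1, ((pick3 C D E s).partner p).rev) := by
  simp only [trace3, if_neg (not_lt.mpr h)]

/-- The outer boundary of the concatenation of three diagrams. -/
def IsOuter3 (x : Fin 3 × Fin (2 * N)) : Prop :=
  (x.1 = 0 ∧ (x.2 : ℕ) < N) ∨ (x.1 = 2 ∧ N ≤ (x.2 : ℕ))

/-- The height label of the arc through a state, for three diagrams. -/
def fragHeight3 (C D E : OkadaDiagram N) (x : Fin 3 × Fin (2 * N)) : ℕ :=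
  (pick3 C D E x.1).height x.2

/-- The boundary when the first two diagrams are considered as one. -/
def BdL (x : Fin 3 × Fin (2 * N)) : Prop :=
  x.1 = 2 ∨ (x.1 = 0 ∧ (x.2 : ℕ) < N) ∨ (x.1 = 1 ∧ N ≤ (x.2 : ℕ))

/-- The boundary when the last two diagrams are considered as one. -/
def BdR (x : Fin 3 × Fin (2 * N)) : Prop :=
  x.1 = 0 ∨ (x.1 = 1 ∧ (x.2 : ℕ) < N) ∨ (x.1 = 2 ∧ N ≤ (x.2 : ℕ))

/-- The states of `(C * D) * E` in the triple concatenation. -/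
def embL (x : Bool × Fin (2 * N)) : Fin 3 × Fin (2 * N) :=
  (if x.1 then 2 else if (x.2 : ℕ) < N then 0 else 1, x.2)

/-- The states of `C * (D * E)` in the triple concatenation. -/
def embR (x : Bool × Fin (2 * N)) : Fin 3 × Fin (2 * N) :=
  (if x.1 then (if (x.2 : ℕ) < N then 1 else 2) else 0, x.2)

theorem ret_left (C D E : OkadaDiagram N) {x y : Bool × Fin (2 * N)} {m : ℕ}
    (h : Ret (trace C D) IsOuter (fragHeight C D) x y m) :
    Ret (trace3 C D E) BdL (fragHeight3 C D E) (if x.1 then 1 else 0, x.2) (2, y.2) m := by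
  induction h with
  | last x hx =>
    obtain ⟨b, p⟩ := x
    have hq : trace3 C D E (if b then 1 else 0, p) = (2, (trace C D (b, p)).2) := by
      rw [trace, isOuter_swap] at hx
      cases b
      · exact trace3_of_lt C D E 0 p ((isOuter_false _).mp hx)
      · exact trace3_of_le C D E 1 p ((isOuter_true _).mp hx)
    have h2 := Ret.last (f := trace3 C D E) (O := BdL) (h := fragHeight3 C D E)
      (if b then 1 else 0, p) (by rw [hq]; exact Or.inl rfl)
    rw [hq] at h2
    cases b <;> exact h2
  | step x y m hx hr ih =>
    obtain ⟨b, p⟩ := x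
    have hq : trace3 C D E (if b then 1 else 0, p) =
        (if (trace C D (b, p)).1 then 1 else 0, (trace C D (b, p)).2) := by
      rw [trace, isOuter_swap] at hx
      cases b
      · exact trace3_of_le C D E 0 p (not_lt.mp (mt (isOuter_false _).mpr hx))
      · exact trace3_of_lt C D E 1 p (not_le.mp (mt (isOuter_true _).mpr hx))
    rw [← hq] at ih
    have h2 := Ret.step _ _ _ (by
      rw [hq]
      generalize trace C D (b, p) = z at hx
      obtain ⟨c, q⟩ := z
      cases c <;> simp [IsOuter, BdL] at hx ⊢ <;> exact hx) ih
    cases b <;> exact h2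

theorem ret_right (C D E : OkadaDiagram N) {x y : Bool × Fin (2 * N)} {m : ℕ}
    (h : Ret (trace D E) IsOuter (fragHeight D E) x y m) :
    Ret (trace3 C D E) BdR (fragHeight3 C D E) (if x.1 then 2 else 1, x.2) (0, y.2) m := by
  induction h with
  | last x hx =>
    obtain ⟨b, p⟩ := x
    have hq : trace3 C D E (if b then 2 else 1, p) = (0, (trace D E (b, p)).2) := by
      rw [trace, isOuter_swap] at hx
      cases b
      · exact trace3_of_lt C D E 1 p ((isOuter_false _).mp hx)
      · exact trace3_of_le C D E 2 p ((isOuter_true _).mp hx)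
    have h2 := Ret.last (f := trace3 C D E) (O := BdR) (h := fragHeight3 C D E)
      (if b then 2 else 1, p) (by rw [hq]; exact Or.inl rfl)
    rw [hq] at h2
    cases b <;> exact h2
  | step x y m hx hr ih =>
    obtain ⟨b, p⟩ := x
    have hq : trace3 C D E (if b then 2 else 1, p) =
        (if (trace D E (b, p)).1 then 2 else 1, (trace D E (b, p)).2) := by
      rw [trace, isOuter_swap] at hx
      cases b
      · exact trace3_of_le C D E 1 p (not_lt.mp (mt (isOuter_false _).mpr hx))
      · exact trace3_of_lt C D E 2 p (not_le.mp (mt (isOuter_true _).mpr hx))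
    rw [← hq] at ih
    have h2 := Ret.step _ _ _ (by
      rw [hq]
      generalize trace D E (b, p) = z at hx
      obtain ⟨c, q⟩ := z
      cases c <;> simp [IsOuter, BdR] at hx ⊢ <;> exact hx) ih
    cases b <;> exact h2

theorem ret_embL (C D E : OkadaDiagram N) (x : Bool × Fin (2 * N)) :
    Ret (trace3 C D E) BdL (fragHeight3 C D E) (embL x) (embL (trace (C * D) E x))
      (fragHeight (C * D) E x) := by
  obtain ⟨b, p⟩ := x
  cases b with
  | false =>
    have h := ret_left C D E (ret_comp C D p)
    have h1 : embL (false, p) = (if (entry p).1 then 1 else 0, (entry p).2) := by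
      by_cases hp : N ≤ (p : ℕ)
      · simp [embL, entry, hp, not_lt.mpr hp]
      · simp [embL, entry, hp, not_le.mp hp]
    rw [h1]
    exact h
  | true =>
    have hq : trace3 C D E (2, p) = embL (trace (C * D) E (true, p)) := by
      have := (E.partner p).isLt
      by_cases hp : (E.partner p : ℕ) < N
      · have h3 : ¬ ((E.partner p).rev : ℕ) < N := by rw [Fin.val_rev]; omega
        refine (trace3_of_lt C D E 2 p hp).trans (Prod.ext ?_ rfl)
        simp only [trace, swap, across, pick, embL, Bool.not_true, if_neg h3]
        rfl
      · have h3 : ((E.partner p).rev : ℕ) < N := by rw [Fin.val_rev]; omega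
        refine (trace3_of_le C D E 2 p (not_lt.mp hp)).trans (Prod.ext ?_ rfl)
        simp only [trace, swap, across, pick, embL, Bool.not_true, if_pos h3]
        rfl
    have h2 := Ret.last (f := trace3 C D E) (O := BdL) (h := fragHeight3 C D E) (2, p) (by
      rw [hq]
      simp only [trace, swap, across, embL, BdL, Bool.not_true]
      generalize ((pick (C * D) E true).partner p).rev = q
      by_cases h : (q : ℕ) < N
      · simp [h]
      · simp [h]; omega)
    rw [hq] at h2
    exact h2

theorem ret_embR (C D E : OkadaDiagram N) (x : Bool × Fin (2 * N)) :
    Ret (trace3 C D E) BdR (fragHeight3 C D E) (embR x) (embR (trace C (D * E) x))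
      (fragHeight C (D * E) x) := by
  obtain ⟨b, p⟩ := x
  cases b with
  | true =>
    have h := ret_right C D E (ret_comp D E p)
    have h1 : embR (true, p) = (if (entry p).1 then 2 else 1, (entry p).2) := by
      by_cases hp : N ≤ (p : ℕ)
      · simp [embR, entry, hp, not_lt.mpr hp]
      · simp [embR, entry, hp, not_le.mp hp]
    rw [h1]
    exact h
  | false =>
    have hq : trace3 C D E (0, p) = embR (trace C (D * E) (false, p)) := by
      have := (C.partner p).isLt
      by_cases hp : (C.partner p : ℕ) < N
      · have h3 : ¬ ((C.partner p).rev : ℕ) < N := by rw [Fin.val_rev]; omega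
        refine (trace3_of_lt C D E 0 p hp).trans (Prod.ext ?_ rfl)
        simp only [trace, swap, across, pick, embR, Bool.not_false, if_neg h3]
        rfl
      · have h3 : ((C.partner p).rev : ℕ) < N := by rw [Fin.val_rev]; omega
        refine (trace3_of_le C D E 0 p (not_lt.mp hp)).trans (Prod.ext ?_ rfl)
        simp only [trace, swap, across, pick, embR, Bool.not_false, if_pos h3]
        rfl
    have h2 := Ret.last (f := trace3 C D E) (O := BdR) (h := fragHeight3 C D E) (0, p) (by
      rw [hq]
      simp only [trace, swap, across, embR, BdR, Bool.not_false]
      generalize ((pick C (D * E) false).partner p).rev = q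
      by_cases h : (q : ℕ) < N
      · simp [h]
      · simp [h]; omega)
    rw [hq] at h2
    exact h2

theorem isOuter3_embL (x : Bool × Fin (2 * N)) : IsOuter3 (embL x) ↔ IsOuter x := by
  obtain ⟨b, p⟩ := x
  cases b <;> by_cases hp : (p : ℕ) < N <;> simp [IsOuter3, IsOuter, embL, hp]

theorem isOuter3_embR (x : Bool × Fin (2 * N)) : IsOuter3 (embR x) ↔ IsOuter x := by
  obtain ⟨b, p⟩ := x
  cases b <;> by_cases hp : (p : ℕ) < N <;> simp [IsOuter3, IsOuter, embR, hp]

theorem embL_entry (p : Fin (2 * N)) : embL (entry p) = embR (entry p) := by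
  by_cases hp : N ≤ (p : ℕ)
  · simp [embL, embR, entry, hp, not_lt.mpr hp]
  · simp [embL, embR, entry, hp, not_le.mp hp]

protected theorem mul_assoc (C D E : OkadaDiagram N) : C * D * E = C * (D * E) := by
  have key : ∀ p, (C * D * E).partner p = (C * (D * E)).partner p ∧
      (C * D * E).height p = (C * (D * E)).height p := by
    intro p
    have h1 := Ret.blocks (O := IsOuter3) embL (fun x hx => by
      unfold IsOuter3 BdL at *; tauto) isOuter3_embL (ret_embL C D E) (ret_comp (C * D) E p)
    have h2 := Ret.blocks (O := IsOuter3) embR (fun x hx => by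
      unfold IsOuter3 BdR at *; tauto) isOuter3_embR (ret_embR C D E) (ret_comp C (D * E) p)
    rw [embL_entry] at h1
    obtain ⟨e1, e2⟩ := h1.unique h2
    exact ⟨Fin.rev_injective (congrArg Prod.snd e1), e2⟩
  ext p
  · exact congrArg Fin.val (key p).1
  · exact (key p).2

theorem min_height_abs (D : OkadaDiagram N) (p : Fin (2 * N)) :
    min (D.height p) (vertexAbs (D.partner p)) = D.height p ∧
      min (vertexAbs p) (D.height p) = D.height p := by
  have := D.height_le p
  omega

theorem vertexAbs_rev (p : Fin (2 * N)) : vertexAbs p.rev = vertexAbs p :=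
  (1 : OkadaDiagram N).height_partner p

protected theorem one_mul (D : OkadaDiagram N) : 1 * D = D := by
  have aux : ∀ p, Ret (trace 1 D) IsOuter (fragHeight 1 D) (true, p)
      (swap (entry (D.partner p))) (D.height p) := by
    intro p
    by_cases hq : N ≤ (D.partner p : ℕ)
    · have e : swap (entry (D.partner p)) = trace 1 D (true, p) := by
        simp [trace, across, pick, entry, hq]
      rw [e]
      exact Ret.last _ (by rw [← e, isOuter_swap]; exact isOuter_entry _)
    · have e1 : trace 1 D (true, p) = (false, (D.partner p).rev) := rfl
      have e2 : swap (entry (D.partner p)) = trace 1 D (false, (D.partner p).rev) := by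
        simp [trace, across, pick, entry, hq, one_partner]
      have h := Ret.last (f := trace 1 D) (O := IsOuter) (h := fragHeight 1 D)
        (false, (D.partner p).rev) (by rw [← e2, isOuter_swap]; exact isOuter_entry _)
      rw [← e2] at h
      have h2 := Ret.step (f := trace 1 D) (true, p) _ _ (by
        rw [e1]; simp [IsOuter, Fin.val_rev]; omega) (e1 ▸ h)
      have h3 : min (fragHeight 1 D (true, p)) (fragHeight 1 D (false, (D.partner p).rev)) =
          D.height p := by
        simp only [fragHeight, pick, one_height, vertexAbs_rev]
        exact (min_height_abs D p).1
      rw [e1, h3] at h2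
      exact h2
  apply eq_of_ret
  intro p
  by_cases hp : N ≤ (p : ℕ)
  · simpa [entry, hp] using aux p
  · have e1 : trace 1 D (entry p) = (true, p) := by
      simp [trace, across, pick, entry, hp, one_partner, swap]
    have h2 := Ret.step (f := trace 1 D) (entry p) _ _ (by
      rw [e1]; simp [IsOuter]; omega) (e1 ▸ aux p)
    have h3 : min (fragHeight 1 D (entry p)) (D.height p) = D.height p := by
      simp only [fragHeight, pick, entry, hp, decide_false, one_height]
      exact (min_height_abs D p).2
    rwa [h3] at h2

protected theorem mul_one (D : OkadaDiagram N) : D * 1 = D := by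
  have aux : ∀ p, Ret (trace D 1) IsOuter (fragHeight D 1) (false, p)
      (swap (entry (D.partner p))) (D.height p) := by
    intro p
    by_cases hq : N ≤ (D.partner p : ℕ)
    · have e1 : trace D 1 (false, p) = (true, (D.partner p).rev) := rfl
      have e2 : swap (entry (D.partner p)) = trace D 1 (true, (D.partner p).rev) := by
        simp [trace, across, pick, entry, hq, one_partner]
      have h := Ret.last (f := trace D 1) (O := IsOuter) (h := fragHeight D 1)
        (true, (D.partner p).rev) (by rw [← e2, isOuter_swap]; exact isOuter_entry _)
      rw [← e2] at h
      have h2 := Ret.step (f := trace D 1) (false, p) _ _ (by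
        rw [e1]; simp [IsOuter, Fin.val_rev]; omega) (e1 ▸ h)
      have h3 : min (fragHeight D 1 (false, p)) (fragHeight D 1 (true, (D.partner p).rev)) =
          D.height p := by
        simp only [fragHeight, pick, one_height, vertexAbs_rev]
        exact (min_height_abs D p).1
      rw [e1, h3] at h2
      exact h2
    · have e : swap (entry (D.partner p)) = trace D 1 (false, p) := by
        simp [trace, across, pick, entry, hq]
      rw [e]
      exact Ret.last _ (by rw [← e, isOuter_swap]; exact isOuter_entry _)
  apply eq_of_ret
  intro p
  by_cases hp : N ≤ (p : ℕ)
  · have e1 : trace D 1 (entry p) = (false, p) := by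
      simp [trace, across, pick, entry, hp, one_partner, swap]
    have h2 := Ret.step (f := trace D 1) (entry p) _ _ (by
      rw [e1]; simp [IsOuter]; omega) (e1 ▸ aux p)
    have h3 : min (fragHeight D 1 (entry p)) (D.height p) = D.height p := by
      simp only [fragHeight, pick, entry, hp, decide_true, one_height]
      exact (min_height_abs D p).2
    rwa [h3] at h2
  · simpa [entry, hp] using aux p

/-- The Okada monoid of rank `N`. -/
instance : Monoid (OkadaDiagram N) where
  mul_assoc := OkadaDiagram.mul_assoc
  one_mul := OkadaDiagram.one_mul
  mul_one := OkadaDiagram.mul_one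

/-! ### Mirror, propagating labels, free elements and Green relations -/

/-- The mirror of a diagram: exchange the vertices `a` and `\overline{a}`. -/
def mirror (D : OkadaDiagram N) : OkadaDiagram N where
  partner p := (D.partner p.rev).rev
  height p := D.height p.rev
  partner_partner p := by rw [Fin.rev_rev, D.partner_partner, Fin.rev_rev]
  partner_ne p h := D.partner_ne p.rev (by rw [← Fin.rev_inj, h, Fin.rev_rev])
  height_partner p := by rw [Fin.rev_rev, D.height_partner]
  noncrossing a c h1 h2 h3 := by
    have h4 : D.partner c.rev < D.partner a.rev := Fin.rev_lt_rev.mp h3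
    have h5 : D.partner a.rev < c.rev := by rw [← Fin.rev_lt_rev, Fin.rev_rev]; exact h2
    have h6 : c.rev < a.rev := Fin.rev_lt_rev.mpr h1
    exact D.noncrossing (D.partner c.rev) (D.partner a.rev) h4
      (by rwa [D.partner_partner]) (by rwa [D.partner_partner, D.partner_partner])
  one_le_height p := D.one_le_height _
  height_le p := by rw [vertexAbs_rev, ← vertexAbs_rev p]; exact D.height_le _
  height_parity p := by rw [vertexAbs_rev, ← vertexAbs_rev p]; exact D.height_parity _
  height_lt_of_nested a c h1 h2 h3 := by
    have h4 : D.partner c.rev < D.partner a.rev := Fin.rev_lt_rev.mp h3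
    have h5 : D.partner a.rev < a.rev := by rw [← Fin.rev_lt_rev, Fin.rev_rev]; exact h2
    have h6 : a.rev < c.rev := Fin.rev_lt_rev.mpr h1
    have := D.height_lt_of_nested (D.partner a.rev) (D.partner c.rev) h4
      (by rwa [D.partner_partner]) (by rwa [D.partner_partner, D.partner_partner])
    rwa [D.height_partner, D.height_partner] at this

/-- An element is involutive if it equals its mirror. -/
def IsInvolutive (e : OkadaDiagram N) : Prop := e = mirror e

/-- The propagating set of a diagram: the labels of the arcs that join a left vertex to a right
vertex. -/
def propLab (D : OkadaDiagram N) : Set ℕ :=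
  {h | ∃ p : Fin (2 * N), (p : ℕ) < N ∧ N ≤ (D.partner p : ℕ) ∧ D.height p = h}

/-- The partner function of an elementary diagram. -/
def elemPartner (i : Fin (N - 1)) (p : Fin (2 * N)) : Fin (2 * N) :=
  if vertexAbs p = (i : ℕ) + 1 then
    (if (p : ℕ) < N then ⟨i + 1, by omega⟩ else ⟨2 * N - 2 - i, by omega⟩)
  else if vertexAbs p = (i : ℕ) + 2 then
    (if (p : ℕ) < N then ⟨i, by omega⟩ else ⟨2 * N - 1 - i, by omega⟩)
  else p.rev

theorem elemPartner_val (i : Fin (N - 1)) (p : Fin (2 * N)) :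
    (elemPartner i p : ℕ) =
      if (p : ℕ) = i then (i : ℕ) + 1 else if (p : ℕ) = i + 1 then (i : ℕ)
      else if (p : ℕ) + 1 + i = 2 * N then 2 * N - 2 - i
      else if (p : ℕ) + 2 + i = 2 * N then 2 * N - 1 - i else 2 * N - 1 - p := by
  have := p.isLt
  have := i.isLt
  have h : (p.rev : ℕ) = 2 * N - 1 - p := by rw [Fin.val_rev]; omega
  unfold elemPartner vertexAbs
  split_ifs <;> first | omega | simp only []

theorem elemPartner_through (i : Fin (N - 1)) (c : Fin (2 * N))
    (h : (c : ℕ) + 1 < elemPartner i c) :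
    (elemPartner i c : ℕ) = 2 * N - 1 - c ∧ (c : ℕ) < N ∧ vertexAbs c ≠ (i : ℕ) + 2 := by
  have := c.isLt
  have := i.isLt
  rw [elemPartner_val] at h ⊢
  unfold vertexAbs
  split_ifs at h ⊢ <;> omega

theorem vertexAbs_elemPartner (i : Fin (N - 1)) (p : Fin (2 * N)) :
    vertexAbs (elemPartner i p) = if vertexAbs p = (i : ℕ) + 1 then (i : ℕ) + 2
      else if vertexAbs p = (i : ℕ) + 2 then (i : ℕ) + 1 else vertexAbs p := by
  have := p.isLt
  have := i.isLt
  have h := vertexAbs_rev p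
  unfold elemPartner
  by_cases h1 : vertexAbs p = (i : ℕ) + 1
  · simp only [if_pos h1]
    unfold vertexAbs at *
    split_ifs at * <;> simp only [] at * <;> omega
  · by_cases h2 : vertexAbs p = (i : ℕ) + 2
    · simp only [if_neg h1, if_pos h2]
      unfold vertexAbs at *
      split_ifs at * <;> simp only [] at * <;> omega
    · simp only [if_neg h1, if_neg h2, h]

/-- The elementary diagram with index `j = i + 1`, where `1 ≤ j ≤ N - 1`: it has the arcs
`j - (j+1)` and `\overline{j} - \overline{j+1}`, both with label `j`, and the arcs
`a - \overline{a}` with label `a` for `a ≠ j, j + 1`. -/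
def elementary (i : Fin (N - 1)) : OkadaDiagram N where
  partner := elemPartner i
  height p := if vertexAbs p = (i : ℕ) + 2 then (i : ℕ) + 1 else vertexAbs p
  partner_partner p := by
    have := p.isLt
    have := i.isLt
    rw [Fin.ext_iff, elemPartner_val, elemPartner_val]
    split_ifs <;> omega
  partner_ne p := by
    have := p.isLt
    have := i.isLt
    rw [Ne, Fin.ext_iff, elemPartner_val]
    split_ifs <;> omega
  height_partner p := by
    rw [vertexAbs_elemPartner]
    split_ifs <;> omega
  noncrossing a c := by
    have := a.isLt
    have := c.isLt
    have := i.isLt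
    simp only [Fin.lt_def]
    intro h1 h2 h3
    have ha := elemPartner_through i a (by omega)
    rw [ha.1] at h2 h3
    rw [elemPartner_val] at h3
    split_ifs at h3 <;> omega
  one_le_height p := by
    have := p.isLt
    unfold vertexAbs
    split_ifs <;> omega
  height_le p := by
    rw [vertexAbs_elemPartner]
    split_ifs <;> omega
  height_parity p := by
    rw [vertexAbs_elemPartner]
    unfold Nat.ModEq
    split_ifs <;> omega
  height_lt_of_nested a c := by
    have := a.isLt
    have := c.isLt
    have := i.isLt
    simp only [Fin.lt_def]
    intro h1 h2 h3
    obtain ⟨hc1, hc2, hc3⟩ := elemPartner_through i c (by omega)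
    rw [if_neg hc3]
    rw [hc1] at h3
    rw [elemPartner_val] at h2 h3
    unfold vertexAbs at hc3 ⊢
    rw [if_pos hc2] at hc3 ⊢
    split_ifs at h2 h3 ⊢ <;> omega

/-- `e` and `f` generate the same right ideal. -/
def GreenR (e f : OkadaDiagram N) : Prop :=
  Set.range (fun g : OkadaDiagram N => e * g) = Set.range (fun g : OkadaDiagram N => f * g)

/-- `e` and `f` generate the same two-sided ideal. -/
def GreenJ (e f : OkadaDiagram N) : Prop :=
  Set.range (fun g : OkadaDiagram N × OkadaDiagram N => g.1 * e * g.2) =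
    Set.range (fun g : OkadaDiagram N × OkadaDiagram N => g.1 * f * g.2)

end OkadaDiagram

/-- Fibonacci sets of rank `N`: subsets `{s₁ < ⋯ < s_k}` of `{1, …, N}` such that `k` has the
parity of `N` and `s_l` has the parity of `l` for all `l`. -/
def IsFibonacciSet (N : ℕ) (S : Finset ℕ) : Prop :=
  S ⊆ Finset.Icc 1 N ∧ S.card ≡ N [MOD 2] ∧
    ∀ s ∈ S, s ≡ (S.filter (fun t => t ≤ s)).card [MOD 2]

/-- The free set of a Fibonacci set `S`: the indices `j = i + 1 ∉ S` such that
`j - max {s ∈ S | s < j}` is odd, where the maximum of the empty set is `0`. -/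
def freeSet (N : ℕ) (S : Finset ℕ) : Finset (Fin (N - 1)) :=
  Finset.univ.filter (fun i => (i : ℕ) + 1 ∉ S ∧
    Odd ((i : ℕ) + 1 - (S.filter (fun s => s < (i : ℕ) + 1)).sup id))

namespace OkadaDiagram

/-- The product of the (pairwise commuting) elementary diagrams with index in the free set of a
Fibonacci set `S`. -/
def freeElement (N : ℕ) (S : Finset ℕ) : OkadaDiagram N :=
  (((freeSet N S).sort (fun a b => a ≤ b)).map elementary).prod

/-- An element is free if it is the free element of some Fibonacci set. -/
def IsFree {N : ℕ} (e : OkadaDiagram N) : Prop :=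
  ∃ S : Finset ℕ, IsFibonacciSet N S ∧ e = freeElement N S

end OkadaDiagram

/-!
The mirror makes the Okada monoid a regular `*`-semigroup: `D * mirror D * D = D`. In such a
semigroup the principal right ideal of `e` is that of the projection `e * star e`, and different
projections generate different right ideals; the projections of the Okada monoid are exactly the
involutive diagrams.

The number of propagating arcs with label at least `t` does not increase in a product, so the
propagating set is an invariant of the two-sided ideal. Conversely, if `D` and `E` have the same
propagating set, the left half of `D` can be glued to the right half of `E` along the propagating
arcs; the resulting diagram is `R`-equivalent to `D` and `L`-equivalent to `E`.

The left arcs below a propagating arc match an even number of vertices, hence propagating sets are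
Fibonacci sets. The free element of a Fibonacci set `S` is a product of distant elementary diagrams,
in which every position outside of `S` belongs to exactly one cup, so its propagating set is `S`.
-/

/-! ### Regular `*`-semigroups -/

/-- A regular `*`-semigroup: a semigroup with an involution `star` such that `star a` is an inverse
of `a` in the sense of von Neumann. The projections `a * star a` then represent the principal right
ideals. -/
class IsRegularStarSemigroup (S : Type*) [Semigroup S] [StarMul S] : Prop where
  mul_star_mul_self (a : S) : a * star a * a = a

namespace IsRegularStarSemigroup

variable {S : Type*} [Semigroup S]

theorem range_mul_mul_subset {a b e f : S} (h : e = a * f * b) :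
    Set.range (fun g : S × S => g.1 * e * g.2) ⊆ Set.range (fun g : S × S => g.1 * f * g.2) := by
  rintro _ ⟨⟨c, d⟩, rfl⟩
  exact ⟨(c * a, b * d), by simp only [h, mul_assoc]⟩

variable [StarMul S] [IsRegularStarSemigroup S]

theorem isStarProjection_mul_star (a : S) : IsStarProjection (a * star a) where
  isIdempotentElem := by rw [IsIdempotentElem, ← mul_assoc, mul_star_mul_self]
  isSelfAdjoint := .mul_star_self a

theorem range_mul_left_eq_iff {a b : S} :
    Set.range (a * ·) = Set.range (b * ·) ↔ a * star a = b * star b := by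
  have mem_range (a : S) : a ∈ Set.range (a * ·) :=
    ⟨star a * a, by simp only [← mul_assoc, mul_star_mul_self]⟩
  constructor
  · intro h
    obtain ⟨x, hx⟩ : a ∈ Set.range (b * ·) := h ▸ mem_range a
    obtain ⟨y, hy⟩ : b ∈ Set.range (a * ·) := h ▸ mem_range b
    have left : b * star b * (a * star a) = a * star a := by
      rw [← hx, ← mul_assoc, ← mul_assoc, mul_star_mul_self]
    have right : a * star a * (b * star b) = b * star b := by
      rw [← hy, ← mul_assoc, ← mul_assoc, mul_star_mul_self]
    calc
      a * star a = star (b * star b * (a * star a)) := by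
        rw [left, (isStarProjection_mul_star a).isSelfAdjoint.star_eq]
      _ = b * star b := by
        rw [star_mul, (isStarProjection_mul_star a).isSelfAdjoint.star_eq,
          (isStarProjection_mul_star b).isSelfAdjoint.star_eq, right]
  · have range_subset {a b : S} (h : a * star a = b * star b) :
        Set.range (a * ·) ⊆ Set.range (b * ·) := by
      rintro _ ⟨x, rfl⟩
      exact ⟨star b * (a * x), by simp only [← mul_assoc, ← h, mul_star_mul_self]⟩
    exact fun h => (range_subset h).antisymm (range_subset h.symm)

theorem existsUnique_isStarProjection (e : S) :
    ∃! p : S, Set.range (e * ·) = Set.range (p * ·) ∧ IsStarProjection p := by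
  have mul_star_eq {p : S} (hp : IsStarProjection p) : p * star p = p := by
    rw [hp.isSelfAdjoint.star_eq, hp.isIdempotentElem.eq]
  have he := isStarProjection_mul_star e
  refine ⟨e * star e, ⟨range_mul_left_eq_iff.mpr (mul_star_eq he).symm, he⟩, ?_⟩
  rintro p ⟨h, hp⟩
  rw [range_mul_left_eq_iff.mp h, mul_star_eq hp]

theorem range_mul_mul_eq {e f g : S} (left : e * star e = g * star g)
    (right : star g * g = star f * f) :
    Set.range (fun x : S × S => x.1 * e * x.2) = Set.range (fun x : S × S => x.1 * f * x.2) := by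
  have factor_e : e = g * star f * f * (star g * e) := calc
    e = g * star g * g * star g * e := by rw [mul_star_mul_self, ← left, mul_star_mul_self]
    _ = g * (star g * g) * star g * e := by simp only [mul_assoc]
    _ = g * star f * f * (star g * e) := by rw [right]; simp only [mul_assoc]
  have factor_f : f = f * star g * e * (star e * g) := calc
    f = f * (star g * g) := by rw [right, ← mul_assoc, mul_star_mul_self]
    _ = f * star g * (g * star g * g) := by rw [mul_star_mul_self, mul_assoc]
    _ = f * star g * e * (star e * g) := by rw [← left]; simp only [mul_assoc]
  exact (range_mul_mul_subset factor_e).antisymm (range_mul_mul_subset factor_f)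

end IsRegularStarSemigroup

namespace OkadaDiagram

variable {N : ℕ} {C D E : OkadaDiagram N} {p q : Fin (2 * N)}

/-! ### Short paths in a product -/

theorem rev_lt_iff : (p.rev : ℕ) < N ↔ N ≤ (p : ℕ) := by
  rw [Fin.val_rev]; omega

theorem le_rev_iff : N ≤ (p.rev : ℕ) ↔ (p : ℕ) < N := by
  rw [Fin.val_rev]; omega

theorem entry_of_lt (hp : (p : ℕ) < N) : entry p = (false, p) := by
  simp [entry, hp]

theorem entry_of_le (hp : N ≤ (p : ℕ)) : entry p = (true, p) := by
  simp [entry, hp]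

theorem isOuter_trace_false : IsOuter (trace C D (false, p)) ↔ (C.partner p : ℕ) < N := by
  rw [trace, isOuter_swap]
  exact isOuter_false _

theorem isOuter_trace_true : IsOuter (trace C D (true, p)) ↔ N ≤ (D.partner p : ℕ) := by
  rw [trace, isOuter_swap]
  exact isOuter_true _

theorem mul_eq_of_ret {m : ℕ}
    (h : Ret (trace C D) IsOuter (fragHeight C D) (entry p) (swap (entry q)) m) :
    (C * D).partner p = q ∧ (C * D).height p = m := by
  obtain ⟨swap_eq, height_eq⟩ := (ret_comp C D p).unique h
  exact ⟨congrArg Prod.snd ((Function.Involutive.injective swap_swap) swap_eq), height_eq⟩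

theorem mul_of_left_arc (hp : (p : ℕ) < N) (h : (C.partner p : ℕ) < N) :
    (C * D).partner p = C.partner p ∧ (C * D).height p = C.height p := by
  apply mul_eq_of_ret
  rw [entry_of_lt hp, entry_of_lt h]
  exact .last (false, p) (isOuter_trace_false.mpr h)

theorem mul_of_through (hp : (p : ℕ) < N) (hC : N ≤ (C.partner p : ℕ))
    (hD : N ≤ (D.partner (C.partner p).rev : ℕ)) :
    (C * D).partner p = D.partner (C.partner p).rev ∧
      (C * D).height p = min (C.height p) (D.height (C.partner p).rev) := by
  apply mul_eq_of_ret
  rw [entry_of_lt hp, entry_of_le hD]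
  exact .step (false, p) _ _ (by rwa [isOuter_trace_false, not_lt])
    (.last (true, (C.partner p).rev) (isOuter_trace_true.mpr hD))

theorem mul_of_bounce (hp : (p : ℕ) < N) (hC : N ≤ (C.partner p : ℕ))
    (hD : (D.partner (C.partner p).rev : ℕ) < N)
    (hC' : (C.partner (D.partner (C.partner p).rev).rev : ℕ) < N) :
    (C * D).partner p = C.partner (D.partner (C.partner p).rev).rev := by
  refine (mul_eq_of_ret (m := min (C.height p) (min (D.height (C.partner p).rev)
    (C.height (D.partner (C.partner p).rev).rev))) ?_).1
  rw [entry_of_lt hp, entry_of_lt hC']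
  exact .step (false, p) _ _ (by rwa [isOuter_trace_false, not_lt])
    (.step (true, (C.partner p).rev) _ _ (by rwa [isOuter_trace_true, not_le])
      (.last (false, (D.partner (C.partner p).rev).rev) (isOuter_trace_false.mpr hC')))

theorem le_partner_of_le_mul_partner (hp : (p : ℕ) < N) (h : N ≤ ((C * D).partner p : ℕ)) :
    N ≤ (C.partner p : ℕ) := by
  by_contra hC
  rw [(mul_of_left_arc hp (not_le.mp hC)).1] at h
  exact hC h

theorem mul_height_le (hp : (p : ℕ) < N) : (C * D).height p ≤ C.height p := by
  have := compHeight_le C D p (compLength_pos C D p)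
  rwa [Function.iterate_zero_apply, entry_of_lt hp] at this

/-! ### The mirror -/

theorem mirror_partner : (mirror D).partner p = (D.partner p.rev).rev := rfl

theorem mirror_height : (mirror D).height p = D.height p.rev := rfl

theorem mirror_mirror (D : OkadaDiagram N) : mirror (mirror D) = D := by
  ext p <;> simp [mirror]

theorem entry_rev : entry p.rev = swap (entry p) := by
  by_cases h : N ≤ (p : ℕ)
  · rw [entry_of_le h, entry_of_lt (rev_lt_iff.mpr h)]; rfl
  · rw [entry_of_lt (not_le.mp h), entry_of_le (le_rev_iff.mpr (not_le.mp h))]; rfl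

theorem trace_mirror (x : Bool × Fin (2 * N)) :
    trace (mirror D) (mirror C) (swap x) = swap (trace C D x) := by
  obtain ⟨b, p⟩ := x
  cases b <;> simp [trace, swap, across, pick, mirror_partner]

theorem fragHeight_mirror (x : Bool × Fin (2 * N)) :
    fragHeight (mirror D) (mirror C) (swap x) = fragHeight C D x := by
  obtain ⟨b, p⟩ := x
  cases b <;> simp [fragHeight, swap, pick, mirror_height]

theorem mirror_mul (C D : OkadaDiagram N) : mirror (C * D) = mirror D * mirror C := by
  refine (eq_of_ret _ _ _ fun p => ?_).symm
  have ret_swap (x : Bool × Fin (2 * N)) :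
      Ret (trace (mirror D) (mirror C)) (fun _ => True) (fragHeight (mirror D) (mirror C))
        (swap x) (swap (trace C D x)) (fragHeight C D x) := by
    rw [← trace_mirror, ← fragHeight_mirror]
    exact .last _ trivial
  have := (ret_comp C D p.rev).blocks swap (fun _ _ => trivial) isOuter_swap ret_swap
  rwa [← entry_rev, Fin.rev_rev, ← entry_rev] at this

instance : StarMul (OkadaDiagram N) where
  star := mirror
  star_involutive := mirror_mirror
  star_mul := mirror_mul

theorem star_eq_mirror (D : OkadaDiagram N) : star D = mirror D := rfl

/-! ### Propagating arcs -/

/-- The arc through the vertex `p` joins a left vertex to a right vertex. -/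
def IsPropagating (D : OkadaDiagram N) (p : Fin (2 * N)) : Prop :=
  (D.partner p : ℕ) < N ↔ N ≤ (p : ℕ)

theorem isPropagating_of_lt (hp : (p : ℕ) < N) : D.IsPropagating p ↔ N ≤ (D.partner p : ℕ) := by
  unfold IsPropagating; omega

theorem isPropagating_partner : D.IsPropagating (D.partner p) ↔ D.IsPropagating p := by
  rw [IsPropagating, IsPropagating, D.partner_partner]; omega

theorem isPropagating_mirror : (mirror D).IsPropagating p ↔ D.IsPropagating p.rev := by
  rw [IsPropagating, IsPropagating, mirror_partner, rev_lt_iff, le_rev_iff]; omega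

theorem mem_propLab_iff_left {t : ℕ} :
    t ∈ D.propLab ↔ ∃ p : Fin (2 * N), (p : ℕ) < N ∧ D.IsPropagating p ∧ D.height p = t :=
  exists_congr fun _ => and_congr_right fun hp => by rw [isPropagating_of_lt hp]

theorem mem_propLab_iff_right {t : ℕ} :
    t ∈ D.propLab ↔ ∃ p : Fin (2 * N), N ≤ (p : ℕ) ∧ D.IsPropagating p ∧ D.height p = t := by
  rw [mem_propLab_iff_left, (Function.Involutive.surjective D.partner_partner).exists]
  refine exists_congr fun p => ?_
  rw [isPropagating_partner, D.height_partner]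
  unfold IsPropagating; omega

theorem IsPropagating.height_modEq (h : D.IsPropagating p) :
    D.height p ≡ vertexAbs p [MOD 2] := by
  have parity := D.height_parity p
  have partner_modEq : (D.partner p : ℕ) ≡ (p : ℕ) + 1 [MOD 2] := by
    rw [← ZMod.natCast_eq_natCast_iff]; push_cast; exact cast_partner D p
  unfold IsPropagating at h
  unfold vertexAbs Nat.ModEq at *
  split_ifs at * <;> omega

theorem IsPropagating.height_lt_of_left (hp : D.IsPropagating p) (hq : D.IsPropagating q)
    (hqN : (q : ℕ) < N) (h : p < q) : D.height p < D.height q := by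
  rw [Fin.lt_def] at h
  rw [isPropagating_of_lt hqN] at hq
  rw [isPropagating_of_lt (h.trans hqN)] at hp
  refine D.height_lt_of_nested q p h (Fin.lt_def.mpr (hqN.trans_le hq)) ?_
  exact (partner_mem_between D h (Fin.lt_def.mpr (hqN.trans_le hp))).2

theorem IsPropagating.height_lt (hp : D.IsPropagating p) (hq : D.IsPropagating q)
    (side : (p : ℕ) < N ↔ (q : ℕ) < N) (h : vertexAbs p < vertexAbs q) :
    D.height p < D.height q := by
  by_cases hqN : (q : ℕ) < N
  · refine hp.height_lt_of_left hq hqN ?_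
    rw [vertexAbs, vertexAbs, if_pos hqN, if_pos (side.mpr hqN)] at h
    exact Fin.lt_def.mpr (by omega)
  · have := IsPropagating.height_lt_of_left (D := mirror D) (p := p.rev) (q := q.rev)
      (by rwa [isPropagating_mirror, Fin.rev_rev]) (by rwa [isPropagating_mirror, Fin.rev_rev])
      (rev_lt_iff.mpr (not_lt.mp hqN))
    rw [mirror_height, mirror_height, Fin.rev_rev, Fin.rev_rev] at this
    rw [vertexAbs, vertexAbs, if_neg hqN, if_neg (mt side.mp hqN)] at h
    exact this (Fin.rev_lt_rev.mpr (Fin.lt_def.mpr (by omega)))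

theorem IsPropagating.eq_of_height_eq (hp : D.IsPropagating p) (hq : D.IsPropagating q)
    (side : (p : ℕ) < N ↔ (q : ℕ) < N) (h : D.height p = D.height q) : p = q := by
  rcases lt_trichotomy (vertexAbs p) (vertexAbs q) with hlt | heq | hgt
  · exact absurd h (hp.height_lt hq side hlt).ne
  · ext
    unfold vertexAbs at heq
    split_ifs at heq <;> omega
  · exact absurd h (hq.height_lt hp side.symm hgt).ne'

/-! ### Okada monoids are regular `*`-semigroups -/

theorem ext_of_left
    (left : ∀ p : Fin (2 * N), (p : ℕ) < N → D.partner p = E.partner p ∧ D.height p = E.height p)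
    (right : ∀ p : Fin (2 * N), (p : ℕ) < N → (mirror D).partner p = (mirror E).partner p ∧
      (mirror D).height p = (mirror E).height p) : D = E := by
  have agree (p : Fin (2 * N)) : D.partner p = E.partner p ∧ D.height p = E.height p := by
    rcases lt_or_ge (p : ℕ) N with hp | hp
    · exact left p hp
    · simpa only [mirror_partner, mirror_height, Fin.rev_rev, Fin.rev_inj] using
        right p.rev (rev_lt_iff.mpr hp)
  ext p
  · exact congrArg Fin.val (agree p).1
  · exact (agree p).2

theorem mul_mirror_of_le (hp : (p : ℕ) < N) (h : N ≤ (D.partner p : ℕ)) :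
    (D * mirror D).partner p = p.rev ∧ (D * mirror D).height p = D.height p := by
  have back : (mirror D).partner (D.partner p).rev = p.rev := by
    rw [mirror_partner, Fin.rev_rev, D.partner_partner]
  obtain ⟨partner_eq, height_eq⟩ :=
    mul_of_through (D := mirror D) hp h (by rwa [back, le_rev_iff])
  rw [mirror_height, Fin.rev_rev, D.height_partner, min_self] at height_eq
  exact ⟨partner_eq.trans back, height_eq⟩

theorem mul_mirror_mul (D : OkadaDiagram N) : D * mirror D * D = D := by
  have left (D : OkadaDiagram N) (p : Fin (2 * N)) (hp : (p : ℕ) < N) :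
      (D * mirror D * D).partner p = D.partner p ∧
        (D * mirror D * D).height p = D.height p := by
    rcases lt_or_ge (D.partner p : ℕ) N with h | h
    · rw [mul_assoc]
      exact mul_of_left_arc hp h
    · obtain ⟨partner_eq, height_eq⟩ := mul_mirror_of_le hp h
      have := mul_of_through (C := D * mirror D) (D := D) hp
        (by rwa [partner_eq, le_rev_iff]) (by rwa [partner_eq, Fin.rev_rev])
      rwa [partner_eq, height_eq, Fin.rev_rev, min_self] at this
  refine ext_of_left (left D) ?_
  rw [mirror_mul, mirror_mul, ← mul_assoc]
  exact left (mirror D)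

instance : IsRegularStarSemigroup (OkadaDiagram N) where
  mul_star_mul_self := mul_mirror_mul

theorem IsInvolutive.ext_of_left (hD : D.IsInvolutive) (hE : E.IsInvolutive)
    (left : ∀ p : Fin (2 * N), (p : ℕ) < N →
      D.partner p = E.partner p ∧ D.height p = E.height p) : D = E :=
  OkadaDiagram.ext_of_left left (by rwa [← hD, ← hE])

theorem isInvolutive_mul_mirror (D : OkadaDiagram N) : (D * mirror D).IsInvolutive := by
  rw [IsInvolutive, mirror_mul, mirror_mirror]

theorem IsInvolutive.partner_eq_rev (hD : D.IsInvolutive) (hp : (p : ℕ) < N)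
    (h : N ≤ (D.partner p : ℕ)) : D.partner p = p.rev := by
  have side : ((D.partner p).rev : ℕ) < N ↔ (p : ℕ) < N := iff_of_true (rev_lt_iff.mpr h) hp
  have propagating : D.IsPropagating p := (isPropagating_of_lt hp).mpr h
  rw [← Fin.rev_inj, Fin.rev_rev]
  refine IsPropagating.eq_of_height_eq (D := D) ?_ propagating side ?_
  · rwa [← isPropagating_mirror, ← hD, isPropagating_partner]
  · rw [← mirror_height, ← hD, D.height_partner]

theorem IsInvolutive.mul_self (hD : D.IsInvolutive) : D * D = D := by
  nth_rewrite 2 [hD]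
  refine (isInvolutive_mul_mirror D).ext_of_left hD fun p hp => ?_
  rcases lt_or_ge (D.partner p : ℕ) N with h | h
  · exact mul_of_left_arc hp h
  · rw [hD.partner_eq_rev hp h]
    exact mul_mirror_of_le hp h

theorem isStarProjection_iff : IsStarProjection D ↔ D.IsInvolutive :=
  ⟨fun h => h.isSelfAdjoint.star_eq.symm, fun h => ⟨h.mul_self, h.symm⟩⟩

theorem existsUnique_isInvolutive (e : OkadaDiagram N) :
    ∃! f : OkadaDiagram N, GreenR e f ∧ f.IsInvolutive := by
  simp only [← isStarProjection_iff]
  exact IsRegularStarSemigroup.existsUnique_isStarProjection e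

/-- `D` and `E` have the same left half: the same arcs between left vertices, and the same labels
at left vertices. -/
def SameLeft (D E : OkadaDiagram N) : Prop :=
  ∀ p : Fin (2 * N), (p : ℕ) < N → D.height p = E.height p ∧
    (D.partner p = E.partner p ∨ N ≤ (D.partner p : ℕ) ∧ N ≤ (E.partner p : ℕ))

theorem SameLeft.mul_mirror_eq (h : SameLeft D E) : D * mirror D = E * mirror E := by
  refine (isInvolutive_mul_mirror D).ext_of_left (isInvolutive_mul_mirror E) fun p hp => ?_
  have mul_mirror_eq_of_le (hD : N ≤ (D.partner p : ℕ)) (hE : N ≤ (E.partner p : ℕ)) :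
      (D * mirror D).partner p = (E * mirror E).partner p ∧
        (D * mirror D).height p = (E * mirror E).height p := by
    rw [(mul_mirror_of_le hp hD).1, (mul_mirror_of_le hp hD).2, (mul_mirror_of_le hp hE).1,
      (mul_mirror_of_le hp hE).2]
    exact ⟨rfl, (h p hp).1⟩
  obtain ⟨height_eq, partner_eq | ⟨hD, hE⟩⟩ := h p hp
  · rcases lt_or_ge (D.partner p : ℕ) N with hD | hD
    · have hE : (E.partner p : ℕ) < N := partner_eq ▸ hD
      rw [(mul_of_left_arc hp hD).1, (mul_of_left_arc hp hD).2, (mul_of_left_arc hp hE).1,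
        (mul_of_left_arc hp hE).2]
      exact ⟨partner_eq, height_eq⟩
    · exact mul_mirror_eq_of_le hD (partner_eq ▸ hD)
  · exact mul_mirror_eq_of_le hD hE

/-! ### Propagating sets are invariants of two-sided ideals -/

/-- The left ends of propagating arcs with label at least `t`. The number of these plays the role of
a rank: it does not increase in a product. -/
def propagatingFrom (D : OkadaDiagram N) (t : ℕ) : Finset (Fin (2 * N)) :=
  Finset.univ.filter fun p => (p : ℕ) < N ∧ N ≤ (D.partner p : ℕ) ∧ t ≤ D.height p

theorem mem_propagatingFrom {t : ℕ} :
    p ∈ D.propagatingFrom t ↔ (p : ℕ) < N ∧ N ≤ (D.partner p : ℕ) ∧ t ≤ D.height p := by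
  simp [propagatingFrom]

theorem card_propagatingFrom_mul_le (C D : OkadaDiagram N) (t : ℕ) :
    ((C * D).propagatingFrom t).card ≤ (C.propagatingFrom t).card := by
  refine Finset.card_le_card fun p hp => ?_
  rw [mem_propagatingFrom] at hp ⊢
  exact ⟨hp.1, le_partner_of_le_mul_partner hp.1 hp.2.1, hp.2.2.trans (mul_height_le hp.1)⟩

theorem card_propagatingFrom_mirror (D : OkadaDiagram N) (t : ℕ) :
    ((mirror D).propagatingFrom t).card = (D.propagatingFrom t).card := by
  have le_mirror (D : OkadaDiagram N) :
      (D.propagatingFrom t).card ≤ ((mirror D).propagatingFrom t).card := by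
    refine Finset.card_le_card_of_injOn (fun p => (D.partner p).rev) (fun p hp => ?_) ?_
    · rw [Finset.mem_coe, mem_propagatingFrom] at hp ⊢
      rw [mirror_partner, mirror_height, Fin.rev_rev, D.partner_partner, D.height_partner,
        rev_lt_iff, le_rev_iff]
      exact ⟨hp.2.1, hp.1, hp.2.2⟩
    · exact (Fin.rev_injective.comp
        (Function.Involutive.injective D.partner_partner)).injOn
  refine le_antisymm ?_ (le_mirror D)
  simpa only [mirror_mirror] using le_mirror (mirror D)

theorem card_propagatingFrom_mul_mul_le (a e b : OkadaDiagram N) (t : ℕ) :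
    ((a * e * b).propagatingFrom t).card ≤ (e.propagatingFrom t).card := by
  refine (card_propagatingFrom_mul_le _ _ t).trans ?_
  rw [← card_propagatingFrom_mirror, mirror_mul, ← card_propagatingFrom_mirror e]
  exact card_propagatingFrom_mul_le _ _ t

theorem mem_propLab_iff_card {t : ℕ} :
    t ∈ D.propLab ↔ (D.propagatingFrom (t + 1)).card < (D.propagatingFrom t).card := by
  have subset : D.propagatingFrom (t + 1) ⊆ D.propagatingFrom t := fun p hp => by
    rw [mem_propagatingFrom] at hp ⊢
    exact ⟨hp.1, hp.2.1, by omega⟩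
  constructor
  · rintro ⟨p, hp, hpartner, height_eq⟩
    refine Finset.card_lt_card ((Finset.ssubset_iff_of_subset subset).mpr ⟨p, ?_, ?_⟩)
    · exact mem_propagatingFrom.mpr ⟨hp, hpartner, height_eq.ge⟩
    · rw [mem_propagatingFrom]; omega
  · intro h
    obtain ⟨p, hp, hp_succ⟩ := Finset.exists_mem_notMem_of_card_lt_card h
    rw [mem_propagatingFrom] at hp hp_succ
    exact ⟨p, hp.1, hp.2.1, by omega⟩

theorem GreenJ.propLab_eq (h : GreenJ D E) : D.propLab = E.propLab := by
  have card_le {D E : OkadaDiagram N} (h : GreenJ D E) (t : ℕ) :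
      (D.propagatingFrom t).card ≤ (E.propagatingFrom t).card := by
    obtain ⟨⟨a, b⟩, rfl⟩ : D ∈ Set.range fun g : OkadaDiagram N × OkadaDiagram N =>
        g.1 * E * g.2 := h ▸ ⟨1, by simp⟩
    exact card_propagatingFrom_mul_mul_le a E b t
  ext t
  simp only [mem_propLab_iff_card, fun t => (card_le h t).antisymm (card_le h.symm t)]

/-! ### Gluing a left half and a right half -/

/-- The diagram that contains the vertex `p` when the left half of `D` is glued to the right half
of `E`. -/
def half (D E : OkadaDiagram N) (p : Fin (2 * N)) : OkadaDiagram N :=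
  if (p : ℕ) < N then D else E

theorem half_of_lt (hp : (p : ℕ) < N) : half D E p = D := if_pos hp

theorem half_of_le (hp : N ≤ (p : ℕ)) : half D E p = E := if_neg (not_lt.mpr hp)

theorem half_congr (side : (p : ℕ) < N ↔ (q : ℕ) < N) : half D E p = half D E q :=
  if_congr side rfl rfl

/-- The vertices `p` and `q` are the ends of an arc when the left half of `D` is glued to the right
half of `E`: this arc either lies in one half, or is formed by two halves of propagating arcs with
the same label. -/
def Joined (D E : OkadaDiagram N) (p q : Fin (2 * N)) : Prop :=
  ((p : ℕ) < N ↔ (q : ℕ) < N) ∧ (half D E p).partner p = q ∨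
    ((p : ℕ) < N ↔ N ≤ (q : ℕ)) ∧ (half D E p).IsPropagating p ∧ (half D E q).IsPropagating q ∧
      (half D E p).height p = (half D E q).height q

namespace Joined

theorem symm (h : Joined D E p q) : Joined D E q p := by
  obtain ⟨side, rfl⟩ | ⟨side, hp, hq, height_eq⟩ := h
  · exact .inl ⟨side.symm, by rw [← half_congr side, partner_partner]⟩
  · exact .inr ⟨by omega, hq, hp, height_eq.symm⟩

theorem height_eq (h : Joined D E p q) : (half D E q).height q = (half D E p).height p := by
  obtain ⟨side, rfl⟩ | ⟨-, -, -, height_eq⟩ := h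
  · rw [← half_congr side, height_partner]
  · exact height_eq.symm

theorem unique {r : Fin (2 * N)} (hq : Joined D E p q) (hr : Joined D E p r) : q = r := by
  obtain ⟨side, rfl⟩ | ⟨side, hp, propagating, height_eq⟩ := hq <;>
  obtain ⟨side', rfl⟩ | ⟨side', hp', propagating', height_eq'⟩ := hr
  · rfl
  · unfold IsPropagating at hp'; omega
  · unfold IsPropagating at hp; omega
  · rw [half_congr (p := q) (q := r) (by omega)] at propagating height_eq
    exact propagating.eq_of_height_eq propagating' (by omega) (height_eq.symm.trans height_eq')

theorem lt_iff {r : Fin (2 * N)} (h : Joined D E p q) (side : (r : ℕ) < N ↔ (p : ℕ) < N) :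
    q < r ↔ (half D E p).partner p < r := by
  obtain ⟨-, rfl⟩ | ⟨opposite, hp, -⟩ := h
  · rfl
  · unfold IsPropagating at hp
    simp only [Fin.lt_def]
    omega

theorem gt_iff {r : Fin (2 * N)} (h : Joined D E p q) (side : (r : ℕ) < N ↔ (p : ℕ) < N) :
    r < q ↔ r < (half D E p).partner p := by
  obtain ⟨-, rfl⟩ | ⟨opposite, hp, -⟩ := h
  · rfl
  · unfold IsPropagating at hp
    simp only [Fin.lt_def]
    omega

theorem ne (h : Joined D E p q) : q ≠ p := by
  rintro rfl
  obtain ⟨-, partner_eq⟩ | ⟨opposite, -⟩ := h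
  · exact partner_ne _ _ partner_eq
  · omega

theorem height_modEq (h : Joined D E p q) :
    (half D E p).height p ≡ min (vertexAbs p) (vertexAbs q) [MOD 2] := by
  obtain ⟨-, rfl⟩ | ⟨-, hp, hq, height_eq⟩ := h
  · exact height_parity _ _
  · rcases min_choice (vertexAbs p) (vertexAbs q) with h | h <;> rw [h]
    · exact hp.height_modEq
    · exact height_eq ▸ hq.height_modEq

theorem not_crossing_of_left {a b c d : Fin (2 * N)} (hab : Joined D E a b) (hcd : Joined D E c d)
    (hcN : (c : ℕ) < N) (hac : a < c) (hcb : c < b) : ¬ b < d := by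
  intro hbd
  have haN : (a : ℕ) < N := (Fin.lt_def.mp hac).trans hcN
  have between := (partner_mem_between D hac (by
    rwa [hab.gt_iff (iff_of_true hcN haN), half_of_lt haN] at hcb)).2
  obtain ⟨side, rfl⟩ | ⟨opposite, hc, hd, height_cd⟩ := hcd
  · rw [half_of_lt hcN] at hbd side
    rw [hab.lt_iff (by omega), half_of_lt haN] at hbd
    exact lt_asymm between hbd
  · rw [half_of_lt hcN] at hc height_cd
    have hcN' := (isPropagating_of_lt hcN).mp hc
    obtain ⟨side, rfl⟩ | ⟨opposite', ha, hb, height_ab⟩ := hab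
    · rw [half_of_lt haN, Fin.lt_def] at *
      omega
    · rw [half_of_lt haN] at ha height_ab
      rw [half_of_le (by omega)] at hb hd height_ab height_cd
      have height_lt := ha.height_lt hc (iff_of_true haN hcN) (by
        unfold vertexAbs; rw [Fin.lt_def] at hac; split_ifs; omega)
      have height_gt := hd.height_lt hb (by omega) (by
        unfold vertexAbs; rw [Fin.lt_def] at hbd; split_ifs <;> omega)
      omega

theorem not_crossing {a b c d : Fin (2 * N)} (hab : Joined D E a b) (hcd : Joined D E c d)
    (hac : a < c) (hcb : c < b) : ¬ b < d := by
  rcases lt_or_ge (c : ℕ) N with hcN | hcN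
  · exact hab.not_crossing_of_left hcd hcN hac hcb
  · intro hbd
    have hbN : N ≤ (b : ℕ) := hcN.trans (Fin.lt_def.mp hcb).le
    rw [hab.symm.lt_iff (by omega), half_of_le hbN] at hac
    rw [hcd.gt_iff (by omega), half_of_le hcN] at hbd
    exact E.noncrossing (E.partner b) c hac (by rwa [E.partner_partner])
      (by rwa [E.partner_partner])

theorem height_lt_of_nested {a b c d : Fin (2 * N)} (hab : Joined D E a b) (hcd : Joined D E c d)
    (hca : c < a) (hlt : a < b) (hbd : b < d) :
    (half D E c).height c < (half D E a).height a := by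
  rcases lt_or_ge (a : ℕ) N with haN | haN
  · have hcN : (c : ℕ) < N := (Fin.lt_def.mp hca).trans haN
    have had := hlt.trans hbd
    rw [hab.gt_iff Iff.rfl] at hlt
    rw [hcd.gt_iff (iff_of_true haN hcN)] at had
    rw [half_of_lt haN, half_of_lt hcN] at *
    exact D.height_lt_of_nested a c hca hlt (partner_mem_between D hca had).2
  · have hbN : N ≤ (b : ℕ) := haN.trans (Fin.lt_def.mp hlt).le
    have hdN : N ≤ (d : ℕ) := hbN.trans (Fin.lt_def.mp hbd).le
    rw [hcd.symm.lt_iff (by omega), half_of_le hdN] at hca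
    rw [hab.gt_iff Iff.rfl, half_of_le haN] at hlt
    rw [hab.lt_iff (by omega), half_of_le haN] at hbd
    rw [← hcd.height_eq, half_of_le haN, half_of_le hdN, ← E.height_partner d]
    exact E.height_lt_of_nested a _ hca hlt (by rwa [E.partner_partner])

end Joined

theorem exists_joined (h : D.propLab = E.propLab) (p : Fin (2 * N)) : ∃ q, Joined D E p q := by
  by_cases hp : (half D E p).IsPropagating p
  · rcases lt_or_ge (p : ℕ) N with hpN | hpN
    · rw [half_of_lt hpN] at hp
      obtain ⟨q, hqN, hq, height_eq⟩ :=
        mem_propLab_iff_right.mp (h ▸ mem_propLab_iff_left.mpr ⟨p, hpN, hp, rfl⟩)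
      refine ⟨q, .inr ⟨iff_of_true hpN hqN, ?_⟩⟩
      rw [half_of_lt hpN, half_of_le hqN]
      exact ⟨hp, hq, height_eq.symm⟩
    · rw [half_of_le hpN] at hp
      obtain ⟨q, hqN, hq, height_eq⟩ :=
        mem_propLab_iff_left.mp (h ▸ mem_propLab_iff_right.mpr ⟨p, hpN, hp, rfl⟩)
      refine ⟨q, .inr ⟨by omega, ?_⟩⟩
      rw [half_of_le hpN, half_of_lt hqN]
      exact ⟨hp, hq, height_eq.symm⟩
  · refine ⟨_, .inl ⟨?_, rfl⟩⟩
    unfold IsPropagating at hp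
    omega

/-- The left half of `D` glued to the right half of `E`. -/
noncomputable def glue (D E : OkadaDiagram N) (h : D.propLab = E.propLab) : OkadaDiagram N :=
  have joined (p : Fin (2 * N)) : Joined D E p (exists_joined h p).choose :=
    (exists_joined h p).choose_spec
  { partner p := (exists_joined h p).choose
    height p := (half D E p).height p
    partner_partner p := (joined _).unique (joined p).symm
    partner_ne p := (joined p).ne
    height_partner p := (joined p).height_eq
    noncrossing a c := (joined a).not_crossing (joined c)
    one_le_height p := one_le_height _ p
    height_le p := le_min (((half D E p).height_le p).trans (min_le_left _ _)) <| by
      rw [← (joined p).height_eq]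
      exact (height_le _ _).trans (min_le_left _ _)
    height_parity p := (joined p).height_modEq
    height_lt_of_nested a c := (joined a).height_lt_of_nested (joined c) }

theorem glue_height (h : D.propLab = E.propLab) :
    (glue D E h).height p = (half D E p).height p := rfl

theorem joined_glue (h : D.propLab = E.propLab) (p : Fin (2 * N)) :
    Joined D E p ((glue D E h).partner p) :=
  (exists_joined h p).choose_spec

theorem sameLeft_glue (h : D.propLab = E.propLab) : SameLeft D (glue D E h) := by
  intro p hp
  refine ⟨by rw [glue_height, half_of_lt hp], ?_⟩
  obtain ⟨-, partner_eq⟩ | ⟨opposite, propagating, -⟩ := joined_glue h p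
  · rw [half_of_lt hp] at partner_eq
    exact .inl partner_eq
  · rw [half_of_lt hp, isPropagating_of_lt hp] at propagating
    exact .inr ⟨propagating, opposite.mp hp⟩

theorem sameLeft_mirror_glue (h : D.propLab = E.propLab) :
    SameLeft (mirror E) (mirror (glue D E h)) := by
  intro p hp
  have hpN : N ≤ (p.rev : ℕ) := le_rev_iff.mpr hp
  simp only [mirror_partner, mirror_height, Fin.rev_inj, le_rev_iff]
  refine ⟨by rw [glue_height, half_of_le hpN], ?_⟩
  obtain ⟨-, partner_eq⟩ | ⟨opposite, propagating, -⟩ := joined_glue h p.rev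
  · rw [half_of_le hpN] at partner_eq
    exact .inl partner_eq
  · rw [half_of_le hpN, IsPropagating] at propagating
    exact .inr ⟨propagating.mpr hpN, by omega⟩

theorem greenJ_iff_propLab_eq : GreenJ D E ↔ D.propLab = E.propLab := by
  refine ⟨GreenJ.propLab_eq, fun h => ?_⟩
  refine IsRegularStarSemigroup.range_mul_mul_eq (sameLeft_glue h).mul_mirror_eq ?_
  simpa only [star_eq_mirror, mirror_mirror] using (sameLeft_mirror_glue h).mul_mirror_eq.symm

/-! ### Propagating sets are Fibonacci sets -/

/-- The propagating set as a finite set. -/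
def propFinset (D : OkadaDiagram N) : Finset ℕ := (D.propagatingFrom 0).image D.height

theorem coe_propFinset (D : OkadaDiagram N) : (D.propFinset : Set ℕ) = D.propLab := by
  ext t
  simp [propFinset, propLab, mem_propagatingFrom, and_assoc]

theorem isPropagating_of_mem (hp : p ∈ D.propagatingFrom 0) : D.IsPropagating p :=
  have := mem_propagatingFrom.mp hp
  (isPropagating_of_lt this.1).mpr this.2.1

theorem injOn_height_propagatingFrom : Set.InjOn D.height (D.propagatingFrom 0) :=
  fun _ hp _ hq => (isPropagating_of_mem hp).eq_of_height_eq (isPropagating_of_mem hq)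
    (iff_of_true (mem_propagatingFrom.mp hp).1 (mem_propagatingFrom.mp hq).1)

theorem height_le_height_iff (hp : p ∈ D.propagatingFrom 0) (hq : q ∈ D.propagatingFrom 0) :
    D.height p ≤ D.height q ↔ p ≤ q := by
  have height_lt {p q : Fin (2 * N)} (hp : p ∈ D.propagatingFrom 0)
      (hq : q ∈ D.propagatingFrom 0) (h : p < q) : D.height p < D.height q :=
    (isPropagating_of_mem hp).height_lt_of_left (isPropagating_of_mem hq)
      (mem_propagatingFrom.mp hq).1 h
  refine ⟨fun h => not_lt.mp fun hlt => (height_lt hq hp hlt).not_ge h, fun h => ?_⟩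
  rcases h.eq_or_lt with rfl | h
  · exact le_rfl
  · exact (height_lt hp hq h).le

theorem card_propagatingFrom_filter_lt_modEq {b : ℕ} (hb : b ≤ N)
    (closed : ∀ y : Fin (2 * N), (y : ℕ) < b → (D.partner y : ℕ) < N → (D.partner y : ℕ) < b) :
    ((D.propagatingFrom 0).filter fun y : Fin (2 * N) => (y : ℕ) < b).card ≡ b [MOD 2] := by
  let initial : Finset (Fin (2 * N)) := Finset.univ.filter fun y => (y : ℕ) < b
  have card_initial : initial.card = b := by
    rw [Fin.card_filter_val_lt]; omega
  have card_left_arcs : ((initial.filter fun y => (D.partner y : ℕ) < N).card : ZMod 2) = 0 := by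
    rw [Finset.filter_filter, ← Finset.sum_boole]
    convert sum_eq_zero_of_closed D (fun y => (y : ℕ) < b ∧ (D.partner y : ℕ) < N)
      (fun y hy => ⟨closed y hy.1 hy.2, by rw [D.partner_partner]; omega⟩)
  have propagating : ((D.propagatingFrom 0).filter fun y : Fin (2 * N) => (y : ℕ) < b) =
      initial.filter fun y => ¬ (D.partner y : ℕ) < N := by
    ext y
    simp only [initial, Finset.mem_filter, mem_propagatingFrom, Finset.mem_univ, true_and]
    omega
  have card_add := Finset.card_filter_add_card_filter_not (s := initial)
    (fun y => (D.partner y : ℕ) < N)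
  rw [propagating, ← ZMod.natCast_eq_natCast_iff, ← card_initial, ← card_add]
  push_cast
  rw [card_left_arcs, zero_add]

theorem propFinset_subset : D.propFinset ⊆ Finset.Icc 1 N := by
  intro s hs
  obtain ⟨p, hp, rfl⟩ := Finset.mem_image.mp hs
  have height_le := (D.height_le p).trans (min_le_left _ _)
  rw [mem_propagatingFrom] at hp
  rw [vertexAbs, if_pos hp.1] at height_le
  exact Finset.mem_Icc.mpr ⟨D.one_le_height p, by omega⟩

theorem card_propFinset_modEq : D.propFinset.card ≡ N [MOD 2] := by
  have := card_propagatingFrom_filter_lt_modEq (D := D) le_rfl fun _ _ => id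
  rwa [Finset.filter_true_of_mem fun y hy => (mem_propagatingFrom.mp hy).1,
    ← Finset.card_image_of_injOn injOn_height_propagatingFrom] at this

theorem height_modEq_card (hp : p ∈ D.propagatingFrom 0) :
    D.height p ≡ (D.propFinset.filter (· ≤ D.height p)).card [MOD 2] := by
  obtain ⟨hpN, hpartner, -⟩ := mem_propagatingFrom.mp hp
  have filter_eq : (D.propagatingFrom 0).filter (D.height · ≤ D.height p) =
      (D.propagatingFrom 0).filter fun y : Fin (2 * N) => (y : ℕ) < (p : ℕ) + 1 :=
    Finset.filter_congr fun y hy => by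
      rw [height_le_height_iff hy hp, Fin.le_def, Nat.lt_succ_iff]
  rw [propFinset, Finset.filter_image, filter_eq, Finset.card_image_of_injOn
    (injOn_height_propagatingFrom.mono (Finset.coe_subset.mpr (Finset.filter_subset _ _)))]
  have height_modEq := (isPropagating_of_mem hp).height_modEq
  rw [vertexAbs, if_pos hpN] at height_modEq
  refine height_modEq.trans (card_propagatingFrom_filter_lt_modEq (by omega) ?_).symm
  intro y hyp hyN
  by_contra hpy
  rcases (Fin.le_def.mpr (Nat.lt_succ_iff.mp hyp)).eq_or_lt with rfl | hlt
  · omega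
  · have : (D.partner p : ℕ) < D.partner y :=
      (partner_mem_between D hlt (Fin.lt_def.mpr (by omega))).2
    omega

theorem isFibonacciSet_propFinset (D : OkadaDiagram N) : IsFibonacciSet N D.propFinset := by
  refine ⟨propFinset_subset, card_propFinset_modEq, fun s hs => ?_⟩
  obtain ⟨p, hp, rfl⟩ := Finset.mem_image.mp hs
  exact height_modEq_card hp

/-! ### Products of distant elementary diagrams -/

/-- On its left side the diagram consists of the arcs `{i + 1, i + 2}` for `i` in `F` (indices are
shifted by one, as in `elementary`) and of propagating arcs that are the same as in the unit. -/
structure HasLeftCups (D : OkadaDiagram N) (F : Set (Fin (N - 1))) : Prop where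
  cup : ∀ i ∈ F, ∀ p q : Fin (2 * N), (p : ℕ) = i → (q : ℕ) = i + 1 → D.partner p = q
  straight : ∀ p : Fin (2 * N), (p : ℕ) < N → (∀ i ∈ F, (p : ℕ) ≠ i ∧ (p : ℕ) ≠ i + 1) →
    D.partner p = p.rev ∧ D.height p = p + 1

theorem hasLeftCups_one : HasLeftCups (1 : OkadaDiagram N) ∅ where
  cup _ hi := hi.elim
  straight p hp _ := by rw [one_partner, one_height, vertexAbs, if_pos hp]; exact ⟨rfl, rfl⟩

theorem hasLeftCups_elementary (k : Fin (N - 1)) : HasLeftCups (elementary k) {k} where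
  cup := by
    intro i hi p q hp hq
    obtain rfl : i = k := hi
    ext
    change (elemPartner i p : ℕ) = q
    rw [elemPartner_val, if_pos hp, hq]
  straight p hp avoids := by
    obtain ⟨ne_left, ne_right⟩ := avoids k rfl
    have := k.isLt
    constructor
    · ext
      change (elemPartner k p : ℕ) = p.rev
      rw [elemPartner_val, Fin.val_rev]
      split_ifs <;> omega
    · simp only [elementary, vertexAbs]
      split_ifs <;> omega

namespace HasLeftCups

variable {F : Set (Fin (N - 1))}

theorem elementary_mul (h : HasLeftCups D F) {k : Fin (N - 1)}
    (distant : ∀ i ∈ F, (k : ℕ) + 1 < i ∨ (i : ℕ) + 1 < k) :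
    HasLeftCups (elementary k * D) (insert k F) where
  cup := by
    have := k.isLt
    rintro i (rfl | hi) p q hp hq
    · have partner_eq := (hasLeftCups_elementary i).cup i rfl p q hp hq
      rw [(mul_of_left_arc (by omega) (by rw [partner_eq]; omega)).1, partner_eq]
    · have := distant i hi
      have := i.isLt
      have elementary_p := ((hasLeftCups_elementary k).straight p (by omega)
        (by rintro _ rfl; omega)).1
      have elementary_q : (elementary k).partner q.rev = q := by
        rw [← ((hasLeftCups_elementary k).straight q (by omega) (by rintro _ rfl; omega)).1,
          partner_partner]
      have bounce := mul_of_bounce (C := elementary k) (D := D) (p := p)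
      rw [elementary_p, Fin.rev_rev, h.cup i hi p q hp hq, elementary_q, le_rev_iff] at bounce
      exact bounce (by omega) (by omega) (by omega) (by omega)
  straight p hp avoids := by
    obtain ⟨partner_k, height_k⟩ := (hasLeftCups_elementary k).straight p hp
      (by rintro _ rfl; exact avoids _ (Set.mem_insert _ _))
    obtain ⟨partner_D, height_D⟩ := h.straight p hp
      fun i hi => avoids i (Set.mem_insert_of_mem _ hi)
    have through := mul_of_through (C := elementary k) (D := D) hp
    rw [partner_k, Fin.rev_rev, partner_D, height_k, height_D, min_self, le_rev_iff] at through
    exact through hp hp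

theorem prod_elementary {l : List (Fin (N - 1))}
    (hl : l.Pairwise fun i j : Fin (N - 1) => (i : ℕ) + 1 < j ∨ (j : ℕ) + 1 < i) :
    HasLeftCups (l.map elementary).prod {i | i ∈ l} := by
  induction l with
  | nil => simpa using hasLeftCups_one
  | cons k l ih =>
    rw [List.pairwise_cons] at hl
    have insert_eq : {i | i ∈ k :: l} = insert k {i | i ∈ l} := by
      ext; simp
    rw [List.map_cons, List.prod_cons, insert_eq]
    exact (ih hl.2).elementary_mul hl.1

theorem propLab_eq (h : HasLeftCups D F) :
    D.propLab = {t | ∃ p < N, t = p + 1 ∧ ∀ i ∈ F, p ≠ i ∧ p ≠ (i : ℕ) + 1} := by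
  ext t
  constructor
  · rintro ⟨p, hp, hpartner, rfl⟩
    have avoids : ∀ i ∈ F, (p : ℕ) ≠ i ∧ (p : ℕ) ≠ i + 1 := by
      intro i hi
      have := i.isLt
      have cup := h.cup i hi ⟨i, by omega⟩ ⟨i + 1, by omega⟩ rfl rfl
      constructor <;> intro hpi
      · rw [show p = ⟨i, by omega⟩ from Fin.ext hpi, cup] at hpartner
        change N ≤ (i : ℕ) + 1 at hpartner
        omega
      · rw [show p = ⟨i + 1, by omega⟩ from Fin.ext hpi, ← cup, partner_partner] at hpartner
        change N ≤ (i : ℕ) at hpartner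
        omega
    exact ⟨p, hp, (h.straight p hp avoids).2, avoids⟩
  · rintro ⟨p, hp, rfl, avoids⟩
    obtain ⟨partner_eq, height_eq⟩ := h.straight ⟨p, by omega⟩ hp avoids
    exact ⟨_, hp, by rw [partner_eq]; exact le_rev_iff.mpr hp, height_eq⟩

end HasLeftCups

end OkadaDiagram

/-! ### Free sets -/

theorem odd_succ_add_count_iff {S : Finset ℕ} {j : ℕ} :
    Odd (j + 1 + Nat.count (· ∈ S) (j + 1)) ↔ (Odd (j + Nat.count (· ∈ S) j) ↔ j ∈ S) := by
  rw [Nat.count_succ]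
  split_ifs with h <;> simp only [h, iff_true, iff_false, Nat.odd_iff] <;> omega

theorem card_filter_lt_eq_count (S : Finset ℕ) (j : ℕ) :
    (S.filter (· < j)).card = Nat.count (· ∈ S) j := by
  rw [Nat.count_eq_card_filter_range]
  congr 1
  ext s
  simp [and_comm]

namespace IsFibonacciSet

variable {N : ℕ} {S : Finset ℕ}

theorem modEq_count_succ (hS : IsFibonacciSet N S) {s : ℕ} (hs : s ∈ S) :
    s ≡ Nat.count (· ∈ S) (s + 1) [MOD 2] := by
  rw [← card_filter_lt_eq_count]
  simpa only [Nat.lt_succ_iff] using hS.2.2 s hs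

theorem odd_add_count_of_mem (hS : IsFibonacciSet N S) {s : ℕ} (hs : s ∈ S) :
    Odd (s + Nat.count (· ∈ S) s) := by
  have := hS.modEq_count_succ hs
  rw [Nat.count_succ, if_pos hs] at this
  rw [Nat.odd_iff]
  unfold Nat.ModEq at this
  omega

theorem odd_succ_add_count_rank (hS : IsFibonacciSet N S) :
    Odd (N + 1 + Nat.count (· ∈ S) (N + 1)) := by
  have := hS.2.1
  rw [← card_filter_lt_eq_count, Finset.filter_true_of_mem fun s hs =>
    Nat.lt_succ_of_le (Finset.mem_Icc.mp (hS.1 hs)).2, Nat.odd_iff]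
  unfold Nat.ModEq at this
  omega

theorem sup_filter_lt_modEq (hS : IsFibonacciSet N S) (j : ℕ) :
    (S.filter (· < j)).sup id ≡ Nat.count (· ∈ S) j [MOD 2] := by
  rw [← card_filter_lt_eq_count]
  rcases (S.filter (· < j)).eq_empty_or_nonempty with empty | nonempty
  · rw [empty]; rfl
  · obtain ⟨m, hm, sup_eq⟩ := Finset.exists_mem_eq_sup _ nonempty id
    have filter_eq : S.filter (· < j) = S.filter (· ≤ m) := by
      refine Finset.filter_congr fun s hs => ⟨fun hsj => ?_, fun hsm => ?_⟩
      · exact (Finset.le_sup (f := id) (Finset.mem_filter.mpr ⟨hs, hsj⟩)).trans sup_eq.le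
      · exact hsm.trans_lt (Finset.mem_filter.mp hm).2
    rw [sup_eq, filter_eq]
    exact hS.2.2 m (Finset.mem_filter.mp hm).1

theorem mem_freeSet_iff (hS : IsFibonacciSet N S) {i : Fin (N - 1)} :
    i ∈ freeSet N S ↔
      (i : ℕ) + 1 ∉ S ∧ Odd ((i : ℕ) + 1 + Nat.count (· ∈ S) (i + 1)) := by
  have sup_le : (S.filter (· < (i : ℕ) + 1)).sup id ≤ i + 1 :=
    Finset.sup_le fun s hs => (Finset.mem_filter.mp hs).2.le
  have := hS.sup_filter_lt_modEq (i + 1)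
  unfold Nat.ModEq at this
  rw [freeSet, Finset.mem_filter, and_iff_right (Finset.mem_univ i), Nat.odd_iff, Nat.odd_iff]
  refine and_congr_right fun _ => ?_
  omega

theorem not_odd_succ_of_mem_freeSet (hS : IsFibonacciSet N S) {i : Fin (N - 1)}
    (hi : i ∈ freeSet N S) : ¬ Odd ((i : ℕ) + 2 + Nat.count (· ∈ S) (i + 2)) := by
  obtain ⟨notMem, odd⟩ := hS.mem_freeSet_iff.mp hi
  rw [odd_succ_add_count_iff]
  exact fun h => notMem (h.mp odd)

theorem add_one_lt_of_mem_freeSet (hS : IsFibonacciSet N S) {i j : Fin (N - 1)}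
    (hi : i ∈ freeSet N S) (hj : j ∈ freeSet N S) (h : i < j) : (i : ℕ) + 1 < j := by
  refine lt_of_le_of_ne (Fin.lt_def.mp h) fun hij => ?_
  have odd := (hS.mem_freeSet_iff.mp hj).2
  rw [← hij] at odd
  exact hS.not_odd_succ_of_mem_freeSet hi odd

theorem exists_mem_freeSet_of_notMem (hS : IsFibonacciSet N S) {p : ℕ} (hp : p < N)
    (notMem : p + 1 ∉ S) : ∃ i ∈ freeSet N S, p = i ∨ p = (i : ℕ) + 1 := by
  by_cases odd : Odd (p + 1 + Nat.count (· ∈ S) (p + 1))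
  · have hpN : p < N - 1 := by
      by_contra hpN
      have odd_rank := hS.odd_succ_add_count_rank
      rw [odd_succ_add_count_iff, show N = p + 1 by omega] at odd_rank
      exact notMem (odd_rank.mp odd)
    exact ⟨⟨p, hpN⟩, hS.mem_freeSet_iff.mpr ⟨notMem, odd⟩, .inl rfl⟩
  · have notMem_p : p ∉ S := fun hpS =>
      odd (odd_succ_add_count_iff.mpr (iff_of_true (hS.odd_add_count_of_mem hpS) hpS))
    have odd_p : Odd (p + Nat.count (· ∈ S) p) := by
      by_contra not_odd
      exact odd (odd_succ_add_count_iff.mpr (iff_of_false not_odd notMem_p))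
    obtain _ | q := p
    · simp at odd_p
    · exact ⟨⟨q, by omega⟩, hS.mem_freeSet_iff.mpr ⟨notMem_p, odd_p⟩, .inr rfl⟩

theorem add_one_mem_iff (hS : IsFibonacciSet N S) {p : ℕ} (hp : p < N) :
    p + 1 ∈ S ↔ ∀ i ∈ freeSet N S, p ≠ i ∧ p ≠ (i : ℕ) + 1 := by
  refine ⟨fun hpS i hi => ⟨?_, ?_⟩, fun avoids => ?_⟩
  · rintro rfl
    exact (hS.mem_freeSet_iff.mp hi).1 hpS
  · rintro rfl
    exact hS.not_odd_succ_of_mem_freeSet hi (hS.odd_add_count_of_mem hpS)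
  · by_contra notMem
    obtain ⟨i, hi, rfl | rfl⟩ := hS.exists_mem_freeSet_of_notMem hp notMem
    · exact (avoids i hi).1 rfl
    · exact (avoids i hi).2 rfl

end IsFibonacciSet

namespace OkadaDiagram

variable {N : ℕ} {S : Finset ℕ}

theorem hasLeftCups_freeElement (hS : IsFibonacciSet N S) :
    HasLeftCups (freeElement N S) (freeSet N S) := by
  have distant : ((freeSet N S).sort fun a b => a ≤ b).Pairwise
      fun i j : Fin (N - 1) => (i : ℕ) + 1 < j ∨ (j : ℕ) + 1 < i :=
    (Finset.sortedLT_sort (freeSet N S)).pairwise.imp_of_mem fun hi hj h =>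
      .inl (hS.add_one_lt_of_mem_freeSet ((Finset.mem_sort _).mp hi) ((Finset.mem_sort _).mp hj) h)
  have cups := HasLeftCups.prod_elementary distant
  simp only [Finset.mem_sort] at cups
  exact cups

theorem propLab_freeElement (hS : IsFibonacciSet N S) : (freeElement N S).propLab = S := by
  ext t
  rw [(hasLeftCups_freeElement hS).propLab_eq]
  constructor
  · rintro ⟨p, hp, rfl, avoids⟩
    exact (hS.add_one_mem_iff hp).mpr avoids
  · intro ht
    obtain ⟨one_le, le⟩ := Finset.mem_Icc.mp (hS.1 ht)
    obtain ⟨p, rfl⟩ := Nat.exists_eq_add_of_le' one_le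
    exact ⟨p, le, rfl, (hS.add_one_mem_iff le).mp ht⟩

theorem existsUnique_isFree (e : OkadaDiagram N) :
    ∃! f : OkadaDiagram N, GreenJ e f ∧ f.IsFree := by
  have fibonacci := isFibonacciSet_propFinset e
  refine ⟨freeElement N e.propFinset, ⟨?_, _, fibonacci, rfl⟩, ?_⟩
  · rw [greenJ_iff_propLab_eq, propLab_freeElement fibonacci, coe_propFinset]
  · rintro _ ⟨h, S, hS, rfl⟩
    rw [greenJ_iff_propLab_eq, propLab_freeElement hS, ← coe_propFinset, Finset.coe_inj] at h
    rw [h]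

end OkadaDiagram

theorem mainTheorem7_general (N : ℕ) :
    (∀ e : OkadaDiagram N, ∃! f : OkadaDiagram N, OkadaDiagram.GreenR e f ∧ f.IsInvolutive) ∧
    (∀ e : OkadaDiagram N, ∃! f : OkadaDiagram N, OkadaDiagram.GreenJ e f ∧ f.IsFree) ∧
    (∀ e f : OkadaDiagram N, OkadaDiagram.GreenJ e f ↔ f.propLab = e.propLab) :=
  ⟨OkadaDiagram.existsUnique_isInvolutive, OkadaDiagram.existsUnique_isFree,
    fun _ _ => OkadaDiagram.greenJ_iff_propLab_eq.trans eq_comm⟩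

theorem mainTheorem7 (N : ℕ) :
    (∀ e : OkadaDiagram N, ∃! f : OkadaDiagram N, OkadaDiagram.GreenR e f ∧ f.IsInvolutive) ∧
    (∀ e : OkadaDiagram N, ∃! f : OkadaDiagram N, OkadaDiagram.GreenJ e f ∧ f.IsFree) ∧
    (∀ e f : OkadaDiagram N, f.IsFree →
      (OkadaDiagram.GreenJ e f ↔ f.propLab = e.propLab)) :=
  have ⟨hR, hJ, propLab⟩ := mainTheorem7_general N
  ⟨hR, hJ, fun e f _ => propLab e f⟩
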